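/- Let $\mathbb{T}$ be the infinite random recursive tree on the vertex set $\mathbb{N}=\{1,2,\ldots\}$: the root is $1$ and, independently for each $i\ge 2$, the parent of $i$ is uniform on $\{1,\ldots,i-1\}$. Independently of $\mathbb{T}$, let $(\epsilon_i)_{i\ge2}$ be i.i.d. standard exponential variables; the edge between $i$ and its parent is removed at time $\epsilon_i$. Let $\Pi(t)=(\Pi_1(t),\Pi_2(t),\ldots)$ be the partition of $\mathbb{N}$ into the sets of vertices still connected after all edges with $\epsilon_i\le t$ have been removed, the blocks being listed in the increasing order of their smallest elements, and let $$X_i(t)=\lim_{n\to\infty} n^{-e^{-t}}\,\#\big(\Pi_i(t)\cap\{1,\ldots,n\}\big)$$ be the weight of the block $\Pi_i(t)$. For $j\ge1$ and $t>0$ put $$\mu_{j,t}(k)=\binom{k-2}{k-j-1}(e^{-t})^{k-j-1}(1-e^{-t})^j,\qquad k\ge j+1.$$ For $1\le j\le k$ and positive integers $k_1,\ldots,k_j$ with $k_1+\cdots+k_j=k$, let $\theta_{j,k}(k_1,\ldots,k_j)$ be the probability that, after $j-1$ edges chosen uniformly at random have been removed from a random recursive tree on $\{1,\ldots,k\}$,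 the sizes of the $j$ resulting subtrees, ordered according to the labels of their roots, are $k_1,\ldots,k_j$. Let $t>0$, $j\ge 1$, $q_1,\ldots,q_{j+1}\ge0$, $q=q_1+\cdots+q_{j+1}$, and set $k_{j+1}=1$. Then, almost surely, the limits defining $X_1(t),\ldots,X_{j+1}(t)$ exist and are finite, the variable $X_1(t)^{q_1}\cdots X_{j+1}(t)^{q_{j+1}}$ is integrable, and $$\mathbb{E}\left(X_1(t)^{q_1}\cdots X_{j+1}(t)^{q_{j+1}}\right)=\sum_{k=j+1}^{\infty}\mu_{j,t}(k)\sum_{\substack{k_1,\ldots,k_j\ge1\\ k_1+\cdots+k_j=k-1}}\theta_{j,k-1}(k_1,\ldots,k_j)\,\frac{\Gamma(k)}{\Gamma(qe^{-t}+k)}\prod_{i=1}^{j+1}\frac{\Gamma(q_i+k_i)}{\Gamma(k_i)},$$ where the series on the right-hand side converges. -/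

import Mathlib

open MeasureTheory ProbabilityTheory Filter Topology

noncomputable section

namespace RRT

/-- The graph on `V` whose edges are indexed by `E`, the edge `e` joining `child e` to `par e`,
after the edges in `cut` have been removed. -/
def cutGraph {V E : Type} (child par : E → V) (cut : Set E) : SimpleGraph V :=
  SimpleGraph.fromRel (fun u w => ∃ e, e ∉ cut ∧ child e = u ∧ par e = w)

/-- `m` is the smallest vertex of its connected component. -/
def IsBlockMin {V : Type} [LinearOrder V] (G : SimpleGraph V) (m : V) : Prop :=
  ∀ v, G.Reachable m v → m ≤ v

/-- The connected components of `G` are listed in the increasing order of their smallest elements,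
starting from the index `0`: `block G i` is the component whose smallest element is preceded by
exactly `i` smallest elements of other components (and is empty if there is no such component). -/
def block {V : Type} [LinearOrder V] (G : SimpleGraph V) (i : ℕ) : Set V :=
  {v | ∃ m, IsBlockMin G m ∧ G.Reachable m v ∧ {m' | IsBlockMin G m' ∧ m' < m}.ncard = i}

/-! Vertices are labelled from `0`: the vertex `v` stands for the integer `v + 1`, so that the root
is `0`. The edge with index `e` joins the vertex `e + 1` to its parent in `{0, …, e}`. -/

/-- Recursive trees with `n` edges, that is with `n + 1` vertices. -/
abbrev RecTree (n : ℕ) : Type := (e : Fin n) → Fin (e + 1)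

/-- The finite recursive tree `T` after the edges in `cut` have been removed. -/
def RecTree.cutGraph {n : ℕ} (T : RecTree n) (cut : Finset (Fin n)) : SimpleGraph (Fin (n + 1)) :=
  RRT.cutGraph (fun e : Fin n => e.succ)
    (fun e : Fin n => Fin.castLE (Nat.succ_le_succ e.isLt.le) (T e)) (cut : Set (Fin n))

open Classical in
/-- `theta j k κ` (for `1 ≤ j ≤ k`) is the probability that, after `j - 1` edges chosen uniformly at
random have been removed from a random recursive tree with `k` vertices (that is, a uniform random
element of `RecTree (k - 1)`), the sizes of the `j` subtrees, listed in the increasing order of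
their roots, are given by `κ`. -/
def theta (j k : ℕ) (κ : Fin j → ℕ) : ℝ :=
  let S : Finset (RecTree (k - 1) × Finset (Fin (k - 1))) :=
    Finset.univ ×ˢ Finset.powersetCard (j - 1) Finset.univ
  ((S.filter fun x => ∀ i : Fin j, (block (x.1.cutGraph x.2) i).ncard = κ i).card : ℝ) / S.card

/-- The law `μ_{j,t}`: the negative binomial law with parameters `j` and `1 - exp (-t)`, shifted by
one, on the integers `k ≥ j + 1`. -/
def mu (j : ℕ) (t : ℝ) (k : ℕ) : ℝ :=
  if j + 1 ≤ k then
    ((k - 2).choose (k - j - 1) : ℝ) * Real.exp (-t) ^ (k - j - 1) * (1 - Real.exp (-t)) ^ j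
  else 0

/-- `parent` is an infinite random recursive tree (`parent e ω` is the parent of the vertex
`e + 1`), and `ε` is an independent family of i.i.d. standard exponential times, `ε e` being the
time at which the edge joining `e + 1` to its parent is removed. -/
structure IsDestruction {Ω : Type*} [MeasurableSpace Ω] (P : Measure Ω)
    (parent : (e : ℕ) → Ω → Fin (e + 1)) (ε : ℕ → Ω → ℝ) : Prop where
  measurable_parent : ∀ e, Measurable (parent e)
  measurable_time : ∀ e, Measurable (ε e)
  parent_uniform : ∀ e (u : Fin (e + 1)), P (parent e ⁻¹' {u}) = ((e : ENNReal) + 1)⁻¹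
  time_exponential : ∀ e, P.map (ε e) = expMeasure 1
  indep_parent : iIndepFun parent P
  indep_time : iIndepFun ε P
  indep_parent_time : IndepFun (fun ω e => parent e ω) (fun ω e => ε e ω) P

/-- For a recursive tree `parent` and removal times `ε`, the block of index `i` (starting from `0`)
of the partition `Π(t)` of the vertices into the clusters that are still connected at time `t`. -/
def clusterAt (parent : (e : ℕ) → Fin (e + 1)) (ε : ℕ → ℝ) (t : ℝ) (i : ℕ) : Set ℕ :=
  block (RRT.cutGraph (fun e : ℕ => e + 1) (fun e : ℕ => (parent e : ℕ)) {e | ε e ≤ t}) i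

/-- The rescaled size `n ^ (- exp (-t)) * #(B ∩ [n])` of a set `B` of vertices, where `[n]` consists
of the first `n` vertices. -/
def rescaledSize (t : ℝ) (B : Set ℕ) (n : ℕ) : ℝ :=
  (n : ℝ) ^ (-Real.exp (-t)) * ((B ∩ {v | v < n}).ncard : ℝ)

/-- The weight of a set of vertices at time `t`: the limit of its rescaled sizes. -/
def weight (t : ℝ) (B : Set ℕ) : ℝ :=
  limUnder atTop (rescaledSize t B)

end RRT

end

namespace RRT

/-! Write `a = exp (-t)` and `q` for the sum of the `q i`. At time `t` each edge is kept with
probability `a`, independently of the tree, so the partition can be built one vertex at a time: a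
new vertex opens the next block if its edge is cut, and otherwise joins a block with probability
proportional to its size.

Consider the product of `Γ(q i + size i) / Γ(size i)` over the first `j + 1` blocks. Once they are
all nonempty, a kept edge landing in block `i` multiplies it by `1 + q i / size i`. Averaging over
the parent gives the mean factor `1 + a q / (n + 1)`, whatever the sizes are. Dividing by `Γ(q a + n
+ 1) / Γ(n + 1)` therefore gives a martingale (`potential`). It is zero until the last of the `j +
1` blocks is born, and its value at that moment is `birth`; hence `sum_edgeProb_potential`, and by
summation `integral_potential`: the mean of `potential` is the sum of the contributions of the
possible birth times.

Letting `n → ∞`, `potential` tends to the product of the `X i ^ q i`, because `Γ(s + m) / Γ(m) ~ m ^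
s`. The integrals converge too, because the square of `potential` is dominated by `potential` with
doubled exponents, whose mean is bounded (`exists_potential_sq_le`, `exists_integral_potential_le`).
The existence of the weights is submartingale convergence for a special choice of `q`.

Finally the birth contributions are computed (`integral_birth`): the birth vertex, counted from `1`,
has law `mu`, and given it the earlier vertices form a uniform recursive tree with `j - 1` uniformly
chosen edges removed, which is `theta`. -/

/-! ### Blocks of a cut recursive tree as level sets of a recursive labelling. -/

/-- If `R` meets every component of `G` through descending paths and the label `c`, constant on
components, enumerates `R` increasingly, then the blocks of `G` are the level sets of `c`. -/
theorem block_eq_setOf_label {V : Type} [LinearOrder V] [WellFoundedLT V] (G : SimpleGraph V)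
    (R : Set V) (c : V → ℕ) (hfin : ∀ m, {m' | m' ∈ R ∧ m' < m}.Finite)
    (hadj : ∀ u w, G.Adj u w → c u = c w) (hdesc : ∀ v, v ∉ R → ∃ w < v, G.Adj v w)
    (hc : ∀ m ∈ R, c m = {m' | m' ∈ R ∧ m' < m}.ncard) (i : ℕ) :
    block G i = {v | c v = i} := by
  have hreach : ∀ u w, G.Reachable u w → c u = c w := by
    rintro u w ⟨p⟩
    induction p with
    | nil => rfl
    | cons h _ ih => rw [hadj _ _ h, ih]
  have hroot : ∀ v, ∃ m ∈ R, m ≤ v ∧ G.Reachable v m := by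
    intro v
    induction v using WellFoundedLT.induction with
    | ind v ih =>
      by_cases hv : v ∈ R
      · exact ⟨v, hv, le_rfl, SimpleGraph.Reachable.refl v⟩
      · obtain ⟨w, hw, ha⟩ := hdesc v hv
        obtain ⟨m, hm, hle, hr⟩ := ih w hw
        exact ⟨m, hm, hle.trans hw.le, ha.reachable.trans hr⟩
  have hlt : ∀ m ∈ R, ∀ m' ∈ R, m < m' → c m < c m' := by
    intro m hm m' hm' h
    rw [hc m hm, hc m' hm']
    refine Set.ncard_lt_ncard ⟨fun x hx => ⟨hx.1, hx.2.trans h⟩, fun hs => ?_⟩ (hfin m')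
    exact lt_irrefl m (hs ⟨hm, h⟩).2
  -- Since `c` is constant on components and strictly increasing on `R`, a component contains only
  -- one element of `R`, and `hroot` puts it below all the vertices of that component.
  have hmin : ∀ m, IsBlockMin G m ↔ m ∈ R := by
    intro m
    constructor
    · intro h
      obtain ⟨m', hm', hle, hr⟩ := hroot m
      rwa [le_antisymm (h m' hr) hle]
    · intro h v hr
      obtain ⟨m', hm', hle, hr'⟩ := hroot v
      have e := hreach _ _ (hr.trans hr')
      rcases lt_trichotomy m m' with h' | h' | h'
      · exact absurd e (hlt _ h _ hm' h').ne
      · exact h' ▸ hle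
      · exact absurd e (hlt _ hm' _ h h').ne'
  ext v
  simp only [block, hmin, Set.mem_ofPred_eq]
  constructor
  · rintro ⟨m, hm, hr, rfl⟩
    rw [← hreach _ _ hr, hc m hm]
  · rintro rfl
    obtain ⟨m, hm, -, hr⟩ := hroot v
    exact ⟨m, hm, hr.symm, by rw [hreach _ _ hr, hc m hm]⟩

/-- A recursive tree on `ℕ` given by the parents of its vertices `e + 1`, together with a mark for
each edge, which is `true` if the edge is removed. -/
abbrev Path : Type := (e : ℕ) → Fin (e + 1) × Bool

/-- The number of removed edges among the first `n` edges. -/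
def cutCount (y : Path) (n : ℕ) : ℕ := ((Finset.range n).filter fun e => (y e).2 = true).card

/-- The index of the block that contains a given vertex. -/
def label (y : Path) : ℕ → ℕ
  | 0 => 0
  | e + 1 => if (y e).2 = true then cutCount y (e + 1) else label y (y e).1
  decreasing_by exact (y e).1.isLt

/-- The number of vertices of the block `i` among the first `n + 1` vertices. -/
def size (y : Path) (i n : ℕ) : ℕ := ((Finset.range (n + 1)).filter fun v => label y v = i).card

lemma cutCount_zero (y : Path) : cutCount y 0 = 0 := by simp [cutCount]

lemma cutCount_succ (y : Path) (n : ℕ) :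
    cutCount y (n + 1) = cutCount y n + if (y n).2 = true then 1 else 0 := by
  rw [cutCount, cutCount, Finset.range_add_one, Finset.filter_insert]
  split_ifs <;> simp

lemma cutCount_mono (y : Path) : Monotone (cutCount y) :=
  monotone_nat_of_le_succ fun n => by rw [cutCount_succ]; omega

lemma label_zero (y : Path) : label y 0 = 0 := by rw [label]

lemma label_succ (y : Path) (e : ℕ) :
    label y (e + 1) = if (y e).2 = true then cutCount y (e + 1) else label y (y e).1 := by
  rw [label]

lemma cutCount_congr {y y' : Path} {n : ℕ} (h : ∀ e < n, y e = y' e) :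
    cutCount y n = cutCount y' n := by
  rw [cutCount, cutCount]
  congr 1
  refine Finset.filter_congr fun e he => ?_
  rw [h e (Finset.mem_range.mp he)]

lemma label_congr {y y' : Path} {n : ℕ} (h : ∀ e < n, y e = y' e) :
    ∀ v ≤ n, label y v = label y' v := by
  intro v
  induction v using Nat.strong_induction_on with
  | _ v ih =>
    intro hv
    rcases v with _ | e
    · simp [label_zero]
    · have hc := cutCount_congr (n := e + 1) fun e' he' => h e' (by omega)
      rw [label_succ, label_succ, h e (by omega), hc]
      have := (y' e).1.isLt
      rw [ih _ (by omega) (by omega)]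

lemma size_congr {y y' : Path} {n : ℕ} (h : ∀ e < n, y e = y' e) (i : ℕ) :
    size y i n = size y' i n := by
  rw [size, size]
  congr 1
  refine Finset.filter_congr fun v hv => ?_
  rw [label_congr h v (by simpa [Nat.lt_succ_iff] using hv)]

lemma label_le_cutCount (y : Path) (n : ℕ) : ∀ v ≤ n, label y v ≤ cutCount y n := by
  intro v
  induction v using Nat.strong_induction_on with
  | _ v ih =>
    intro hv
    rcases v with _ | e
    · simp [label_zero]
    · rw [label_succ]
      have := (y e).1.isLt
      split_ifs
      · exact cutCount_mono y hv
      · exact ih _ (by omega) (by omega)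

lemma size_zero_right (y : Path) (i : ℕ) : size y i 0 = if i = 0 then 1 else 0 := by
  rw [size, Finset.range_one, Finset.filter_singleton, label_zero]
  by_cases h : i = 0
  · simp [h]
  · simp [h, Ne.symm h]

lemma size_succ (y : Path) (i n : ℕ) :
    size y i (n + 1) = size y i n + if label y (n + 1) = i then 1 else 0 := by
  rw [size, size, Finset.range_add_one, Finset.filter_insert]
  split_ifs <;> simp

/-- Each removed edge opens the next unused label, so no label is skipped. -/
lemma size_pos_iff (y : Path) (i n : ℕ) : 0 < size y i n ↔ i ≤ cutCount y n := by
  constructor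
  · intro h
    obtain ⟨v, hv⟩ := Finset.card_pos.mp h
    rw [Finset.mem_filter, Finset.mem_range, Nat.lt_succ_iff] at hv
    exact hv.2 ▸ label_le_cutCount y n v hv.1
  · induction n with
    | zero => intro h; rw [cutCount_zero] at h; rw [size_zero_right, if_pos (by omega)]; omega
    | succ n ih =>
      intro h
      rw [size_succ]
      by_cases h' : i ≤ cutCount y n
      · have := ih h'; omega
      · rw [cutCount_succ] at h
        have hc : (y n).2 = true := by by_contra hc; rw [if_neg hc] at h; omega
        rw [if_pos hc] at h
        rw [label_succ, if_pos hc, cutCount_succ, if_pos hc, if_pos (by omega)]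
        omega

lemma size_eq_zero_iff (y : Path) (i n : ℕ) : size y i n = 0 ↔ cutCount y n < i := by
  have := size_pos_iff y i n
  omega

lemma size_le (y : Path) (i n : ℕ) : size y i n ≤ n + 1 :=
  (Finset.card_filter_le _ _).trans (by simp)

lemma sum_size (y : Path) (n j : ℕ) (h : cutCount y n < j) :
    ∑ i ∈ Finset.range j, size y i n = n + 1 := by
  have := Finset.card_eq_sum_card_fiberwise (f := label y) (s := Finset.range (n + 1))
    (t := Finset.range j) (fun v hv => by
      simp only [Finset.coe_range, Set.mem_Iio] at hv ⊢
      exact (label_le_cutCount y n v (by omega)).trans_lt h)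
  rw [Finset.card_range] at this
  exact this.symm

/-- The extra `1` counts the vertex `0`, which is a root without any removed edge. -/
lemma ncard_roots (y : Path) (e : ℕ) :
    {v | (v = 0 ∨ ∃ e', v = e' + 1 ∧ (y e').2 = true) ∧ v < e + 1}.ncard = cutCount y e + 1 := by
  have : {v | (v = 0 ∨ ∃ e', v = e' + 1 ∧ (y e').2 = true) ∧ v < e + 1} =
      ((insert 0 (((Finset.range e).filter fun e => (y e).2 = true).map
        ⟨Nat.succ, Nat.succ_injective⟩) : Finset ℕ) : Set ℕ) := by
    ext v
    simp only [Set.mem_ofPred_eq, Finset.coe_insert, Finset.coe_map, Function.Embedding.coeFn_mk,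
      Set.mem_insert_iff, Set.mem_image, Finset.coe_filter, Finset.mem_range]
    constructor
    · rintro ⟨rfl | ⟨e', rfl, h⟩, hlt⟩
      · exact Or.inl rfl
      · exact Or.inr ⟨e', ⟨by omega, h⟩, rfl⟩
    · rintro (rfl | ⟨e', ⟨h, h'⟩, rfl⟩)
      · exact ⟨Or.inl rfl, by omega⟩
      · exact ⟨Or.inr ⟨e', rfl, h'⟩, Nat.succ_lt_succ h⟩
  rw [this, Set.ncard_coe_finset, Finset.card_insert_of_notMem (by simp), Finset.card_map, cutCount]

/-- The blocks of a forest on an initial segment `f : V ↪o ℕ` of the integers, obtained by removing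
the marked edges of a recursive tree, are the level sets of `label`. -/
theorem block_eq_label {V : Type} [LinearOrder V] (f : V ↪o ℕ)
    (hf : ∀ v, ∀ n < f v, n ∈ Set.range f) (G : SimpleGraph V) (y : Path)
    (hG : ∀ u w, G.Adj u w ↔ ∃ e, (y e).2 = false ∧
      ((f u = e + 1 ∧ f w = (y e).1) ∨ (f w = e + 1 ∧ f u = (y e).1))) (i : ℕ) :
    block G i = {v | label y (f v) = i} := by
  have : WellFoundedLT V := ⟨f.ltEmbedding.isWellFounded.wf⟩
  set R : Set V := {v | f v = 0 ∨ ∃ e', f v = e' + 1 ∧ (y e').2 = true} with hR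
  have himg : ∀ m, f '' {m' | m' ∈ R ∧ m' < m} =
      {v | (v = 0 ∨ ∃ e', v = e' + 1 ∧ (y e').2 = true) ∧ v < f m} := by
    intro m
    ext v
    constructor
    · rintro ⟨m', ⟨h, h'⟩, rfl⟩
      exact ⟨h, f.lt_iff_lt.mpr h'⟩
    · rintro ⟨h, h'⟩
      obtain ⟨m', rfl⟩ := hf m v h'
      exact ⟨m', ⟨h, f.lt_iff_lt.mp h'⟩, rfl⟩
  refine block_eq_setOf_label G R (fun v => label y (f v)) (fun m => ?_) ?_ ?_ ?_ i
  · refine Set.Finite.of_finite_image ?_ f.injective.injOn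
    rw [himg]
    exact (Set.finite_lt_nat (f m)).subset fun v hv => hv.2
  · have key : ∀ u w e, (y e).2 = false → f u = e + 1 → f w = (y e).1 →
        label y (f u) = label y (f w) := by
      intro u w e he hu hw
      rw [hu, hw, label_succ, if_neg (by simp [he])]
    intro u w h
    obtain ⟨e, he, ⟨hu, hw⟩ | ⟨hw, hu⟩⟩ := (hG u w).mp h
    · exact key u w e he hu hw
    · exact (key w u e he hw hu).symm
  · intro v hv
    simp only [hR, Set.mem_ofPred_eq, not_or, not_exists, not_and, Bool.not_eq_true] at hv
    obtain ⟨e, he⟩ := Nat.exists_eq_succ_of_ne_zero hv.1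
    have hlt := (y e).1.isLt
    obtain ⟨w, hw⟩ := hf v (y e).1 (by omega)
    exact ⟨w, f.lt_iff_lt.mp (by omega), (hG v w).mpr ⟨e, hv.2 e he, Or.inl ⟨he, hw⟩⟩⟩
  · intro m hm
    rw [← Set.ncard_image_of_injective _ f.injective, himg]
    rcases hm with hm | ⟨e, hm, he⟩
    · simp [hm, label_zero]
    · rw [hm, ncard_roots, label_succ, if_pos he, cutCount_succ, if_pos he]

/-- The path of a finite recursive tree with removed edges, completed arbitrarily. -/
def ofTree {n : ℕ} (x : RecTree n × Finset (Fin n)) : Path := fun e =>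
  if h : e < n then (x.1 ⟨e, h⟩, decide (⟨e, h⟩ ∈ x.2)) else (0, false)

/-- The restriction of a path to its first `n` edges. -/
def toTree (n : ℕ) (y : Path) : RecTree n × Finset (Fin n) :=
  (fun e => (y e).1, Finset.univ.filter fun e => (y e).2 = true)

lemma ofTree_toTree (n : ℕ) (y : Path) : ∀ e < n, ofTree (toTree n y) e = y e := by
  intro e he
  simp [ofTree, toTree, he]

lemma toTree_eq_iff {n : ℕ} (x : RecTree n × Finset (Fin n)) (y : Path) :
    toTree n y = x ↔ ∀ e < n, y e = ofTree x e := by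
  constructor
  · rintro rfl e he
    exact (ofTree_toTree n y e he).symm
  · intro h
    refine Prod.ext ?_ ?_
    · funext e
      have := h e e.isLt
      simp only [ofTree, e.isLt, dite_true] at this
      simp [toTree, this]
    · ext e
      have := h e e.isLt
      simp only [ofTree, e.isLt, dite_true] at this
      simp [toTree, this]

lemma cutCount_ofTree {n : ℕ} (x : RecTree n × Finset (Fin n)) :
    cutCount (ofTree x) n = x.2.card := by
  rw [cutCount, ← Finset.card_map Fin.valEmbedding]
  congr 1
  ext e
  simp only [Finset.mem_filter, Finset.mem_range, Finset.mem_map, Fin.valEmbedding_apply]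
  constructor
  · rintro ⟨he, h⟩
    simp only [ofTree, he, dite_true, decide_eq_true_eq] at h
    exact ⟨_, h, rfl⟩
  · rintro ⟨e, h, rfl⟩
    exact ⟨e.isLt, by simpa [ofTree] using h⟩

lemma ncard_block_ofTree {n : ℕ} (x : RecTree n × Finset (Fin n)) (i : ℕ) :
    (block (x.1.cutGraph x.2) i).ncard = size (ofTree x) i n := by
  have h := block_eq_label (Fin.valOrderEmb (n + 1))
    (fun v m hm => ⟨⟨m, lt_trans hm v.isLt⟩, rfl⟩) (x.1.cutGraph x.2) (ofTree x) (fun u w => ?_) i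
  · rw [h, size, ← Set.ncard_coe_finset, ← Set.ncard_image_of_injective _ Fin.val_injective]
    congr 1
    ext v
    simp only [Fin.valOrderEmb_apply, Set.mem_image, Set.mem_ofPred_eq, Finset.coe_filter,
      Finset.mem_range]
    constructor
    · rintro ⟨v, hv, rfl⟩
      exact ⟨v.isLt, hv⟩
    · rintro ⟨hv, h⟩
      exact ⟨⟨v, hv⟩, h, rfl⟩
  · have hr : ∀ u w : Fin (n + 1), (∃ e, e ∉ (x.2 : Set (Fin n)) ∧ e.succ = u ∧
        Fin.castLE (Nat.succ_le_succ e.isLt.le) (x.1 e) = w) ↔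
        ∃ e, ((ofTree x) e).2 = false ∧ (u : ℕ) = e + 1 ∧ (w : ℕ) = (ofTree x e).1 := by
      intro u w
      constructor
      · rintro ⟨e, he, rfl, rfl⟩
        refine ⟨e, ?_, ?_, ?_⟩
        · simpa [ofTree] using he
        · simp
        · simp [ofTree]
      · rintro ⟨e, he, hu, hw⟩
        have hen : e < n := by have := u.isLt; omega
        simp only [ofTree, hen, dite_true, decide_eq_false_iff_not] at he hw
        refine ⟨⟨e, hen⟩, he, ?_, ?_⟩
        · ext; simp [hu]
        · ext; simp [hw]
    simp only [RecTree.cutGraph, RRT.cutGraph, SimpleGraph.fromRel_adj, hr, Fin.valOrderEmb_apply]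
    constructor
    · rintro ⟨-, ⟨e, h0, h⟩ | ⟨e, h0, h⟩⟩
      · exact ⟨e, h0, Or.inl h⟩
      · exact ⟨e, h0, Or.inr h⟩
    · rintro ⟨e, h0, h | h⟩
      · refine ⟨fun huw => ?_, Or.inl ⟨e, h0, h⟩⟩
        have := (ofTree x e).1.isLt
        rw [huw] at h; omega
      · refine ⟨fun huw => ?_, Or.inr ⟨e, h0, h⟩⟩
        have := (ofTree x e).1.isLt
        rw [huw] at h; omega

lemma clusterAt_eq (parent : (e : ℕ) → Fin (e + 1)) (ε : ℕ → ℝ) (t : ℝ) (i : ℕ) :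
    clusterAt parent ε t i = {v | label (fun e => (parent e, decide (ε e ≤ t))) v = i} := by
  refine block_eq_label (RelEmbedding.refl _) (fun v m _ => ⟨m, rfl⟩) _ _ (fun u w => ?_) i
  simp only [RRT.cutGraph, SimpleGraph.fromRel_adj, RelEmbedding.refl_apply, Set.mem_ofPred_eq,
    decide_eq_false_iff_not]
  constructor
  · rintro ⟨-, ⟨e, h0, h1, h2⟩ | ⟨e, h0, h1, h2⟩⟩
    · exact ⟨e, h0, Or.inl ⟨h1.symm, h2.symm⟩⟩
    · exact ⟨e, h0, Or.inr ⟨h1.symm, h2.symm⟩⟩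
  · rintro ⟨e, h0, ⟨h1, h2⟩ | ⟨h1, h2⟩⟩
    · have := (parent e).isLt
      exact ⟨by omega, Or.inl ⟨e, h0, h1.symm, h2.symm⟩⟩
    · have := (parent e).isLt
      exact ⟨by omega, Or.inr ⟨e, h0, h1.symm, h2.symm⟩⟩

/-! ### Ratios of Gamma functions and their asymptotics. -/

/-- The ratio `Γ(s + m) / Γ(m)`, which vanishes at `m = 0`. -/
noncomputable def gammaRatio (s : ℝ) (m : ℕ) : ℝ := Real.Gamma (s + m) / Real.Gamma m

-- This rests on the default values `Real.Gamma 0 = 0` and `x / 0 = 0`. It holds even for `s = 0`,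
-- which makes `potential` vanish while one of its blocks is empty.
@[simp] lemma gammaRatio_zero_right (s : ℝ) : gammaRatio s 0 = 0 := by
  simp [gammaRatio, Real.Gamma_zero]

lemma gammaRatio_zero_left {m : ℕ} (hm : 0 < m) : gammaRatio 0 m = 1 := by
  have : 0 < Real.Gamma m := Real.Gamma_pos_of_pos (by exact_mod_cast hm)
  simp [gammaRatio, this.ne']

lemma gammaRatio_one_left (m : ℕ) : gammaRatio 1 m = m := by
  rcases Nat.eq_zero_or_pos m with rfl | hm
  · simp
  have h0 : (0 : ℝ) < m := by exact_mod_cast hm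
  have : 0 < Real.Gamma m := Real.Gamma_pos_of_pos h0
  rw [gammaRatio, add_comm, Real.Gamma_add_one h0.ne']
  field_simp

lemma gammaRatio_pos {s : ℝ} (hs : 0 ≤ s) {m : ℕ} (hm : 0 < m) : 0 < gammaRatio s m := by
  have h0 : (0 : ℝ) < m := by exact_mod_cast hm
  exact div_pos (Real.Gamma_pos_of_pos (by positivity)) (Real.Gamma_pos_of_pos h0)

lemma gammaRatio_nonneg {s : ℝ} (hs : 0 ≤ s) (m : ℕ) : 0 ≤ gammaRatio s m := by
  rcases Nat.eq_zero_or_pos m with rfl | hm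
  · simp
  · exact (gammaRatio_pos hs hm).le

lemma gammaRatio_succ {s : ℝ} (hs : 0 ≤ s) {m : ℕ} (hm : 0 < m) :
    gammaRatio s (m + 1) = gammaRatio s m * (1 + s / m) := by
  have h0 : (0 : ℝ) < m := by exact_mod_cast hm
  have h1 : 0 < Real.Gamma m := Real.Gamma_pos_of_pos h0
  have h2 : s + m ≠ 0 := by positivity
  rw [gammaRatio, gammaRatio, Nat.cast_succ, ← add_assoc, Real.Gamma_add_one h2,
    Real.Gamma_add_one h0.ne']
  field_simp
  ring

lemma Gamma_add_natCast_add_one {s : ℝ} (hs : 0 < s) (n : ℕ) :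
    Real.Gamma (s + n + 1) = (∏ j ∈ Finset.range (n + 1), (s + j)) * Real.Gamma s := by
  induction n with
  | zero => simp [Real.Gamma_add_one hs.ne']
  | succ n ih =>
    have h : s + ((n + 1 : ℕ) : ℝ) ≠ 0 := by positivity
    rw [Real.Gamma_add_one h, Finset.prod_range_succ, Nat.cast_succ, ← add_assoc, ih]
    ring

/-- Euler's limit formula: the product in the denominator of `Real.GammaSeq s m` is `Γ(s + m + 1) /
Γ(s)`, and the factor `1 + s / m` turns `m! / Γ(s + m + 1)` into `Γ(m) / Γ(s + m)`. -/
lemma tendsto_rpow_div_gammaRatio {s : ℝ} (hs : 0 ≤ s) :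
    Tendsto (fun m : ℕ => (m : ℝ) ^ s / gammaRatio s m) atTop (𝓝 1) := by
  rcases hs.eq_or_lt with rfl | hs
  · refine tendsto_const_nhds.congr' ?_
    filter_upwards [eventually_gt_atTop 0] with m hm
    simp [gammaRatio_zero_left hm]
  have h1 : Tendsto (fun m : ℕ => Real.GammaSeq s m / Real.Gamma s * (1 + s / (m : ℝ))) atTop
      (𝓝 (Real.Gamma s / Real.Gamma s * (1 + 0))) :=
    ((Real.GammaSeq_tendsto_Gamma s).div_const _).mul
      (tendsto_const_nhds.add (tendsto_const_div_atTop_nhds_zero_nat s))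
  have hG := Real.Gamma_pos_of_pos hs
  rw [div_self hG.ne', add_zero, one_mul] at h1
  refine h1.congr' ?_
  filter_upwards [eventually_gt_atTop 0] with m hm
  have h0 : (0 : ℝ) < m := by exact_mod_cast hm
  have hp : 0 < ∏ j ∈ Finset.range (m + 1), (s + j) := Finset.prod_pos fun j _ => by positivity
  have h2 := Gamma_add_natCast_add_one hs m
  have h3 : Real.Gamma (s + m + 1) = (s + m) * Real.Gamma (s + m) :=
    Real.Gamma_add_one (by positivity)
  have h4 : (m.factorial : ℝ) = m * Real.Gamma m := by
    rw [← Real.Gamma_nat_eq_factorial, Real.Gamma_add_one h0.ne']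
  have h5 : 0 < Real.Gamma m := Real.Gamma_pos_of_pos h0
  have h6 : 0 < Real.Gamma (s + m) := Real.Gamma_pos_of_pos (by positivity)
  have h7 : (∏ j ∈ Finset.range (m + 1), (s + j)) = (s + m) * Real.Gamma (s + m) / Real.Gamma s := by
    rw [eq_div_iff hG.ne', ← h2, h3]
  rw [Real.GammaSeq, gammaRatio, h7, h4]
  field_simp
  ring

lemma exists_gammaRatio_bounds {s : ℝ} (hs : 0 ≤ s) :
    ∃ C : ℝ, 0 < C ∧ ∀ m : ℕ, 0 < m →
      gammaRatio s m ≤ C * (m : ℝ) ^ s ∧ (m : ℝ) ^ s ≤ C * gammaRatio s m := by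
  have h1 := tendsto_rpow_div_gammaRatio hs
  have h2 := h1.inv₀ one_ne_zero
  obtain ⟨C₁, h1⟩ := h1.bddAbove_range
  obtain ⟨C₂, h2⟩ := h2.bddAbove_range
  refine ⟨max 1 (max C₁ C₂), by positivity, fun m hm => ?_⟩
  have h0 : (0 : ℝ) < m := by exact_mod_cast hm
  have hg := gammaRatio_pos hs hm
  have hp := Real.rpow_pos_of_pos h0 s
  have e1 := h1 ⟨m, rfl⟩
  have e2 := h2 ⟨m, rfl⟩
  simp only [inv_div] at e1 e2
  rw [div_le_iff₀ hg] at e1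
  rw [div_le_iff₀ hp] at e2
  constructor
  · exact e2.trans (mul_le_mul_of_nonneg_right (by simp) hp.le)
  · exact e1.trans (mul_le_mul_of_nonneg_right (by simp) hg.le)

/-- If `N n / d n → x` with `d n → ∞`, then `gammaRatio s (N n) / d n ^ s → x ^ s`. -/
lemma tendsto_gammaRatio_div {s : ℝ} (hs : 0 ≤ s) {N : ℕ → ℕ} {d : ℕ → ℝ} {x : ℝ}
    (hN : ∀ᶠ n in atTop, 0 < N n) (hd : Tendsto d atTop atTop)
    (h : Tendsto (fun n => (N n : ℝ) / d n) atTop (𝓝 x)) :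
    Tendsto (fun n => gammaRatio s (N n) / d n ^ s) atTop (𝓝 (x ^ s)) := by
  have hd0 : ∀ᶠ n in atTop, 0 < d n := hd.eventually_gt_atTop 0
  have hx : 0 ≤ x := ge_of_tendsto h (hd0.mono fun n hn => by positivity)
  have hpow : Tendsto (fun n => (N n : ℝ) ^ s / d n ^ s) atTop (𝓝 (x ^ s)) := by
    refine (h.rpow_const (Or.inr hs)).congr' (hd0.mono fun n hn => ?_)
    rw [Real.div_rpow (by positivity) hn.le]
  rcases hs.eq_or_lt with rfl | hs'
  · simp only [Real.rpow_zero, div_one]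
    exact tendsto_const_nhds.congr' (hN.mono fun n hn => (gammaRatio_zero_left hn).symm)
  -- If `x = 0`, then `N` need not tend to infinity, so the asymptotic equivalence is replaced by
  -- the uniform upper bound.
  rcases hx.eq_or_lt with rfl | hx'
  · obtain ⟨C, hC, hb⟩ := exists_gammaRatio_bounds hs
    have h2 := hpow.const_mul C
    rw [Real.zero_rpow hs'.ne'] at h2 ⊢
    rw [mul_zero] at h2
    refine squeeze_zero' ?_ ?_ h2
    · exact hd0.mono fun n hn => div_nonneg (gammaRatio_nonneg hs _) (by positivity)
    · filter_upwards [hd0, hN] with n h0 h1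
      rw [← mul_div_assoc]
      exact div_le_div_of_nonneg_right (hb _ h1).1 (by positivity)
  · have hNtop : Tendsto N atTop atTop := by
      rw [← tendsto_natCast_atTop_iff (R := ℝ)]
      refine (hd.atTop_mul_pos hx' h).congr' (hd0.mono fun n hn => ?_)
      field_simp
    have h2 := ((tendsto_rpow_div_gammaRatio hs).inv₀ one_ne_zero).comp hNtop
    have h3 := h2.mul hpow
    rw [inv_one, one_mul] at h3
    refine h3.congr' ?_
    filter_upwards [hN] with n h1
    have h1' : (0 : ℝ) < N n := by exact_mod_cast h1
    have := Real.rpow_pos_of_pos h1' s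
    simp only [Function.comp, inv_div]
    field_simp

/-! ### The law of the percolated tree, local functions and submartingales. -/

/-- The law of one edge: uniform parent, and mark `false` with probability `a`. -/
noncomputable def edgeProb (a : ℝ) (e : ℕ) (x : Fin (e + 1) × Bool) : ℝ :=
  (if x.2 = true then 1 - a else a) / (e + 1)

/-- `Y` is an infinite random recursive tree whose edges are kept independently with
probability `a`. -/
structure IsPercolation {Ω : Type*} [MeasurableSpace Ω] (P : Measure Ω) (a : ℝ)
    (Y : Ω → Path) : Prop where
  measurable : ∀ e, Measurable fun ω => Y ω e
  cylinder : ∀ (y : Path) (n : ℕ),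
    P.real {ω | ∀ e < n, Y ω e = y e} = ∏ e ∈ Finset.range n, edgeProb a e (y e)

/-- `f` depends only on the first `n` edges. -/
def IsLocal {β : Type*} (n : ℕ) (f : Path → β) : Prop :=
  ∀ y y' : Path, (∀ e < n, y e = y' e) → f y = f y'

lemma IsLocal.mono {β : Type*} {n m : ℕ} {f : Path → β} (hf : IsLocal n f) (h : n ≤ m) :
    IsLocal m f := fun y y' hy => hf y y' fun e he => hy e (he.trans_le h)

lemma isLocal_toTree (n : ℕ) : IsLocal n (toTree n) := by
  intro y y' h
  rw [toTree_eq_iff]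
  intro e he
  rw [h e he, ofTree_toTree n y' e he]

/-- Local functions take finitely many values, one per cylinder; their measurability, integrability
and integrals thus reduce to finite sums. -/
lemma eq_sum_indicator {Ω : Type*} {n : ℕ} {f : Path → ℝ} (hf : IsLocal n f) (Y : Ω → Path) :
    (fun ω => f (Y ω)) = fun ω => ∑ x : RecTree n × Finset (Fin n),
      {ω | ∀ e < n, Y ω e = ofTree x e}.indicator (fun _ => f (ofTree x)) ω := by
  classical
  funext ω
  simp only [Set.indicator_apply, Set.mem_ofPred_eq, ← toTree_eq_iff]
  rw [Finset.sum_ite_eq, if_pos (Finset.mem_univ _)]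
  exact hf _ _ fun e he => (ofTree_toTree n (Y ω) e he).symm

section

variable {Ω : Type*} [MeasurableSpace Ω] {P : Measure Ω} {a : ℝ}
  {Y : Ω → Path}

lemma IsPercolation.measurableSet_cylinder (hY : IsPercolation P a Y) (y : Path) (n : ℕ) :
    MeasurableSet {ω | ∀ e < n, Y ω e = y e} := by
  have : {ω | ∀ e < n, Y ω e = y e} = ⋂ e, ⋂ _ : e < n, (fun ω => Y ω e) ⁻¹' {y e} := by
    ext ω; simp
  rw [this]
  exact MeasurableSet.iInter fun e => MeasurableSet.iInter fun _ =>
    hY.measurable e (measurableSet_singleton _)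

lemma IsPercolation.measurable_comp (hY : IsPercolation P a Y) {n : ℕ} {f : Path → ℝ}
    (hf : IsLocal n f) : Measurable (fun ω => f (Y ω)) := by
  rw [eq_sum_indicator hf Y]
  exact Finset.measurable_sum _ fun x _ =>
    measurable_const.indicator (hY.measurableSet_cylinder _ _)

variable [IsProbabilityMeasure P]

lemma IsPercolation.integrable (hY : IsPercolation P a Y) {n : ℕ} {f : Path → ℝ}
    (hf : IsLocal n f) : Integrable (fun ω => f (Y ω)) P := by
  rw [eq_sum_indicator hf Y]
  exact integrable_finsetSum _ fun x _ =>
    (integrable_const _).indicator (hY.measurableSet_cylinder _ _)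

lemma IsPercolation.setIntegral_eq_sum (hY : IsPercolation P a Y) {n : ℕ} {f : Path → ℝ}
    (hf : IsLocal n f) (S : Set Ω) :
    ∫ ω in S, f (Y ω) ∂P = ∑ x : RecTree n × Finset (Fin n),
      P.real ({ω | ∀ e < n, Y ω e = ofTree x e} ∩ S) * f (ofTree x) := by
  rw [eq_sum_indicator hf Y, integral_finsetSum _ fun x _ =>
    (integrable_const _).indicator (hY.measurableSet_cylinder _ _)]
  refine Finset.sum_congr rfl fun x _ => ?_
  rw [integral_indicator_const _ (hY.measurableSet_cylinder _ _), smul_eq_mul,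
    measureReal_restrict_apply (hY.measurableSet_cylinder _ _)]

lemma IsPercolation.integral_eq_sum (hY : IsPercolation P a Y) {n : ℕ} {f : Path → ℝ}
    (hf : IsLocal n f) :
    ∫ ω, f (Y ω) ∂P = ∑ x : RecTree n × Finset (Fin n),
      (∏ e ∈ Finset.range n, edgeProb a e (ofTree x e)) * f (ofTree x) := by
  rw [← setIntegral_univ, hY.setIntegral_eq_sum hf]
  simp only [Set.inter_univ, hY.cylinder]

/-- Independence of the edge `n` from the previous ones, read off from the product formula for
cylinders. -/
lemma IsPercolation.setIntegral_edge (hY : IsPercolation P a Y) {n : ℕ} {f : Path → ℝ}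
    (hf : IsLocal n f) (x : Fin (n + 1) × Bool) :
    ∫ ω in {ω | Y ω n = x}, f (Y ω) ∂P = edgeProb a n x * ∫ ω, f (Y ω) ∂P := by
  rw [hY.setIntegral_eq_sum hf, hY.integral_eq_sum hf, Finset.mul_sum]
  refine Finset.sum_congr rfl fun z _ => ?_
  have : {ω | ∀ e < n, Y ω e = ofTree z e} ∩ {ω | Y ω n = x} =
      {ω | ∀ e < n + 1, Y ω e = Function.update (ofTree z) n x e} := by
    ext ω
    simp only [Set.mem_inter_iff, Set.mem_ofPred_eq, Nat.forall_lt_succ_right,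
      Function.update_self]
    refine and_congr_left' (forall₂_congr fun e he => ?_)
    rw [Function.update_of_ne he.ne]
  rw [this, hY.cylinder, Finset.prod_range_succ, Function.update_self,
    Finset.prod_congr rfl fun e he => by
      rw [Function.update_of_ne (Finset.mem_range.mp he).ne]]
  ring

/-- Integrating out the edge `n`. -/
lemma IsPercolation.integral_succ (hY : IsPercolation P a Y) {n : ℕ} {f : Path → ℝ}
    (hf : IsLocal (n + 1) f) :
    ∫ ω, f (Y ω) ∂P =
      ∫ ω, ∑ x, edgeProb a n x * f (Function.update (Y ω) n x) ∂P := by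
  have hloc : ∀ x, IsLocal n fun y => f (Function.update y n x) := by
    intro x y y' h
    refine hf _ _ fun e he => ?_
    rcases (Nat.lt_succ_iff.mp he).eq_or_lt with rfl | he
    · simp
    · simp [he.ne, h e he]
  have hS : ∀ x, MeasurableSet {ω | Y ω n = x} := fun x =>
    hY.measurable n (measurableSet_singleton x)
  have hfun : (fun ω => f (Y ω)) = fun ω => ∑ x,
      {ω | Y ω n = x}.indicator (fun ω => f (Function.update (Y ω) n x)) ω := by
    classical
    funext ω
    simp only [Set.indicator_apply, Set.mem_ofPred_eq]
    rw [Finset.sum_ite_eq, if_pos (Finset.mem_univ _), Function.update_eq_self]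
  rw [hfun, integral_finsetSum _ fun x _ => (hY.integrable (hloc x)).indicator (hS x),
    integral_finsetSum _ fun x _ => (hY.integrable (hloc x)).const_mul _]
  refine Finset.sum_congr rfl fun x _ => ?_
  rw [integral_indicator (hS x), hY.setIntegral_edge (hloc x), integral_const_mul]

/-- The filtration of the first edges. -/
def IsPercolation.filtration (hY : IsPercolation P a Y) :
    Filtration ℕ (inferInstance : MeasurableSpace Ω) where
  seq n := MeasurableSpace.comap (fun ω => toTree n (Y ω)) ⊤
  mono' n m h := by
    rintro s ⟨S, -, rfl⟩
    refine ⟨(fun x => toTree n (ofTree x)) ⁻¹' S, trivial, ?_⟩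
    ext ω
    simp only [Set.mem_preimage]
    rw [isLocal_toTree n (ofTree (toTree m (Y ω))) (Y ω) fun e he =>
      ofTree_toTree m (Y ω) e (he.trans_le h)]
  le' n := by
    rintro s ⟨S, -, rfl⟩
    have : (fun ω => toTree n (Y ω)) ⁻¹' S =
        ⋃ x ∈ S, {ω | ∀ e < n, Y ω e = ofTree x e} := by
      ext ω
      simp [← toTree_eq_iff]
    rw [this]
    exact MeasurableSet.biUnion S.to_countable fun x _ => hY.measurableSet_cylinder _ _

/-- A process with nonnegative conditional increments is a submartingale. -/
lemma IsPercolation.submartingale (hY : IsPercolation P a Y) {f : ℕ → Path → ℝ}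
    (hf : ∀ n, IsLocal n (f n))
    (hstep : ∀ n y, f n y ≤ ∑ x, edgeProb a n x * f (n + 1) (Function.update y n x)) :
    Submartingale (fun n ω => f n (Y ω)) hY.filtration P := by
  classical
  refine submartingale_of_setIntegral_le_succ (fun n => ?_) (fun n => hY.integrable (hf n)) ?_
  · refine Measurable.stronglyMeasurable ?_
    have : (fun ω => f n (Y ω)) = (fun x => f n (ofTree x)) ∘ fun ω => toTree n (Y ω) := by
      funext ω
      exact hf n _ _ fun e he => (ofTree_toTree n (Y ω) e he).symm
    rw [this]
    intro s _
    exact ⟨(fun x => f n (ofTree x)) ⁻¹' s, trivial, rfl⟩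
  · rintro n s hs
    have hs' := hY.filtration.le n s hs
    obtain ⟨S, -, rfl⟩ := hs
    -- The event depends on the first `n` edges only, so its indicator can be absorbed into a local
    -- function and is unaffected by resampling the edge `n`.
    set F : ℕ → Path → ℝ := fun m y => if toTree n y ∈ S then f m y else 0 with hF
    have hint : ∀ m, ∫ ω in (fun ω => toTree n (Y ω)) ⁻¹' S, f m (Y ω) ∂P =
        ∫ ω, F m (Y ω) ∂P := by
      intro m
      rw [← integral_indicator hs']
      rfl
    have hloc : ∀ m, n ≤ m → IsLocal m (F m) := by
      intro m hm y y' h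
      simp only [hF]
      rw [(isLocal_toTree n).mono hm y y' h, hf m y y' h]
    rw [hint, hint, hY.integral_succ (hloc (n + 1) (Nat.le_succ n))]
    refine integral_mono (hY.integrable (hloc n le_rfl)) (hY.integrable (n := n)
      (f := fun y => ∑ x, edgeProb a n x * F (n + 1) (Function.update y n x)) ?_) fun ω => ?_
    · intro y y' h
      refine Finset.sum_congr rfl fun x _ => ?_
      rw [hloc (n + 1) (Nat.le_succ n)]
      intro e he
      rcases (Nat.lt_succ_iff.mp he).eq_or_lt with rfl | he
      · simp
      · simp [he.ne, h e he]
    · have hu : ∀ x, toTree n (Function.update (Y ω) n x) = toTree n (Y ω) := fun x =>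
        isLocal_toTree n _ _ fun e he => by rw [Function.update_of_ne he.ne]
      simp only [hF, hu]
      split_ifs
      · exact hstep n (Y ω)
      · simp

end

/-- The time `t` being fixed, an exponential time matters only through whether it exceeds `t`, which
has probability `exp (-t)`. -/
lemma IsDestruction.isPercolation {Ω : Type*} [MeasurableSpace Ω] {P : Measure Ω}
    [IsProbabilityMeasure P] {parent : (e : ℕ) → Ω → Fin (e + 1)} {ε : ℕ → Ω → ℝ}
    (h : IsDestruction P parent ε) {t : ℝ} (ht : 0 < t) :
    IsPercolation P (Real.exp (-t)) fun ω e => (parent e ω, decide (ε e ω ≤ t)) where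
  measurable e := by
    refine (h.measurable_parent e).prodMk ?_
    refine measurable_to_bool ?_
    have : (fun ω => decide (ε e ω ≤ t)) ⁻¹' {true} = ε e ⁻¹' Set.Iic t := by
      ext ω; simp
    rw [this]
    exact h.measurable_time e measurableSet_Iic
  cylinder y n := by
    have hexp : ∀ e, P.real (ε e ⁻¹' Set.Iic t) = 1 - Real.exp (-t) := by
      intro e
      have : IsProbabilityMeasure (expMeasure 1) := isProbabilityMeasure_expMeasure one_pos
      rw [← map_measureReal_apply (h.measurable_time e) measurableSet_Iic,
        h.time_exponential e, ← cdf_eq_real, cdf_expMeasure_eq one_pos, if_pos ht.le, one_mul]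
    set s : ℕ → Set ℝ := fun e => if (y e).2 = true then Set.Iic t else (Set.Iic t)ᶜ with hs
    have hsm : ∀ e, MeasurableSet (s e) := by
      intro e
      simp only [hs]
      split_ifs
      · exact measurableSet_Iic
      · exact measurableSet_Iic.compl
    have hsp : ∀ e, P.real (ε e ⁻¹' s e) =
        if (y e).2 = true then 1 - Real.exp (-t) else Real.exp (-t) := by
      intro e
      simp only [hs]
      split_ifs
      · exact hexp e
      · rw [Set.preimage_compl, probReal_compl_eq_one_sub
          (h.measurable_time e measurableSet_Iic), hexp e]
        ring
    have hev : {ω | ∀ e < n, (parent e ω, decide (ε e ω ≤ t)) = y e} =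
        (fun ω e => parent e ω) ⁻¹' (⋂ e ∈ Finset.range n, (fun z => z e) ⁻¹' {(y e).1}) ∩
        (fun ω e => ε e ω) ⁻¹' (⋂ e ∈ Finset.range n, (fun z => z e) ⁻¹' s e) := by
      ext ω
      simp only [Set.mem_ofPred_eq, Set.mem_inter_iff, Set.mem_preimage, Set.mem_iInter,
        Finset.mem_range, Set.mem_singleton_iff, ← forall_and]
      refine forall₂_congr fun e _ => ?_
      rw [Prod.ext_iff]
      refine and_congr_right fun _ => ?_
      simp only [hs]
      rcases (y e).2 <;> simp
    rw [hev, Measure.real, h.indep_parent_time.measure_inter_preimage_eq_mul _ _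
      (Finset.measurableSet_biInter _ fun e _ =>
        measurable_pi_apply e (measurableSet_singleton _))
      (Finset.measurableSet_biInter _ fun e _ =>
        measurable_pi_apply e (hsm e))]
    simp only [Set.preimage_iInter]
    have h1 := h.indep_parent.measure_inter_preimage_eq_mul (Finset.range n)
      (sets := fun e => {(y e).1}) fun e _ => measurableSet_singleton _
    have h2 := h.indep_time.measure_inter_preimage_eq_mul (Finset.range n)
      (sets := s) fun e _ => hsm e
    have e1 : P (⋂ e ∈ Finset.range n, (fun ω e => parent e ω) ⁻¹' ((fun z => z e) ⁻¹' {(y e).1})) =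
        ∏ e ∈ Finset.range n, P (parent e ⁻¹' {(y e).1}) := h1
    have e2 : P (⋂ e ∈ Finset.range n, (fun ω e => ε e ω) ⁻¹' ((fun z => z e) ⁻¹' s e)) =
        ∏ e ∈ Finset.range n, P (ε e ⁻¹' s e) := h2
    rw [e1, e2, ENNReal.toReal_mul, ENNReal.toReal_prod, ENNReal.toReal_prod,
      ← Finset.prod_mul_distrib]
    refine Finset.prod_congr rfl fun e _ => ?_
    have := hsp e
    rw [Measure.real] at this
    rw [this, h.parent_uniform, edgeProb, ENNReal.toReal_inv, div_eq_inv_mul]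
    congr 2

/-! ### The potential and its one-step conditional expectation. -/

section

variable {a : ℝ} {j : ℕ} {q : Fin (j + 1) → ℝ}

/-- The normalized product of the moments of the sizes of the first `j + 1` blocks. It vanishes as
long as one of them is empty. -/
noncomputable def potential (a : ℝ) {j : ℕ} (q : Fin (j + 1) → ℝ) (n : ℕ) (y : Path) : ℝ :=
  (gammaRatio ((∑ i, q i) * a) (n + 1))⁻¹ * ∏ i, gammaRatio (q i) (size y i n)

/-- The value of `potential` just after the removal of the edge `n`, if this creates the
block `j`. -/
noncomputable def birth (a : ℝ) {j : ℕ} (q : Fin (j + 1) → ℝ) (n : ℕ) (y : Path) : ℝ :=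
  if cutCount y n + 1 = j then
    (gammaRatio ((∑ i, q i) * a) (n + 2))⁻¹ *
      ∏ i : Fin (j + 1), gammaRatio (q i) (size y i n + if (i : ℕ) = j then 1 else 0)
  else 0

lemma isLocal_potential (a : ℝ) (q : Fin (j + 1) → ℝ) (n : ℕ) : IsLocal n (potential a q n) := by
  intro y y' h
  simp only [potential, size_congr h]

lemma isLocal_birth (a : ℝ) (q : Fin (j + 1) → ℝ) (n : ℕ) : IsLocal n (birth a q n) := by
  intro y y' h
  simp only [birth, size_congr h, cutCount_congr h]

lemma potential_nonneg (ha : 0 ≤ a) (hq : ∀ i, 0 ≤ q i) (n : ℕ) (y : Path) :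
    0 ≤ potential a q n y :=
  mul_nonneg (inv_nonneg.mpr (gammaRatio_nonneg
    (mul_nonneg (Finset.sum_nonneg fun i _ => hq i) ha) _))
    (Finset.prod_nonneg fun i _ => gammaRatio_nonneg (hq i) _)

lemma birth_nonneg (ha : 0 ≤ a) (hq : ∀ i, 0 ≤ q i) (n : ℕ) (y : Path) : 0 ≤ birth a q n y := by
  rw [birth]
  split_ifs
  · exact mul_nonneg (inv_nonneg.mpr (gammaRatio_nonneg
      (mul_nonneg (Finset.sum_nonneg fun i _ => hq i) ha) _))
      (Finset.prod_nonneg fun i _ => gammaRatio_nonneg (hq i) _)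
  · exact le_rfl

lemma size_update_true (y : Path) (n i : ℕ) (u : Fin (n + 1)) :
    size (Function.update y n (u, true)) i (n + 1) =
      size y i n + if cutCount y n + 1 = i then 1 else 0 := by
  have h : ∀ e < n, Function.update y n (u, true) e = y e := fun e he => by
    rw [Function.update_of_ne he.ne]
  rw [size_succ, size_congr h, label_succ, cutCount_succ, cutCount_congr h]
  simp

lemma size_update_false (y : Path) (n i : ℕ) (u : Fin (n + 1)) :
    size (Function.update y n (u, false)) i (n + 1) =
      size y i n + if label y u = i then 1 else 0 := by
  have h : ∀ e < n, Function.update y n (u, false) e = y e := fun e he => by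
    rw [Function.update_of_ne he.ne]
  rw [size_succ, size_congr h, label_succ]
  simp [label_congr h u (Nat.lt_succ_iff.mp u.isLt)]

/-- At most one factor changes, by `gammaRatio_succ`; none does if the new vertex joins a block `l >
j`. -/
lemma prod_gammaRatio_add_one (hq : ∀ i, 0 ≤ q i) (N : Fin (j + 1) → ℕ) (hN : ∀ i, 0 < N i)
    (l : ℕ) : ∏ i, gammaRatio (q i) (N i + if l = (i : ℕ) then 1 else 0) =
      (∏ i, gammaRatio (q i) (N i)) * (1 + ∑ i : Fin (j + 1), if l = (i : ℕ) then q i / N i else 0) := by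
  have h1 : ∀ i : Fin (j + 1), gammaRatio (q i) (N i + if l = (i : ℕ) then 1 else 0) =
      gammaRatio (q i) (N i) * if l = (i : ℕ) then 1 + q i / N i else 1 := by
    intro i
    split_ifs
    · exact gammaRatio_succ (hq i) (hN i)
    · rw [add_zero, mul_one]
  rw [Finset.prod_congr rfl fun i _ => h1 i, Finset.prod_mul_distrib]
  congr 1
  by_cases hl : l < j + 1
  · have h2 : ∀ i : Fin (j + 1), l = (i : ℕ) ↔ (⟨l, hl⟩ : Fin (j + 1)) = i := fun i => by
      rw [Fin.ext_iff]
    simp only [h2]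
    rw [Finset.prod_ite_eq, Finset.sum_ite_eq]
    simp
  · have h2 : ∀ i : Fin (j + 1), l ≠ (i : ℕ) := fun i => by have := i.isLt; omega
    simp [h2]

/-- Block `i` offers `size y i n` parents, each contributing `q i / size y i n`: the sizes cancel,
which is why a deterministic normalization suffices. -/
lemma sum_label_div (y : Path) (n : ℕ) (hK : j ≤ cutCount y n) :
    ∑ u : Fin (n + 1), ∑ i : Fin (j + 1),
      (if label y u = (i : ℕ) then q i / (size y i n : ℝ) else 0) = ∑ i, q i := by
  rw [Finset.sum_comm]
  refine Finset.sum_congr rfl fun i _ => ?_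
  have hpos : 0 < size y i n := (size_pos_iff y i n).mpr (by have := i.isLt; omega)
  rw [Fin.sum_univ_eq_sum_range
    (fun u => if label y u = (i : ℕ) then q i / (size y i n : ℝ) else 0),
    ← Finset.sum_filter, Finset.sum_const, nsmul_eq_mul]
  change (size y i n : ℝ) * _ = _
  field_simp

/-- The conditional expectation of `potential` at the next step. -/
lemma sum_edgeProb_potential (ha : 0 ≤ a) (hq : ∀ i, 0 ≤ q i) (n : ℕ) (y : Path) :
    ∑ x, edgeProb a n x * potential a q (n + 1) (Function.update y n x) =
      potential a q n y + (1 - a) * birth a q n y := by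
  have hn : (0 : ℝ) < n + 1 := by positivity
  set s := (∑ i, q i) * a with hs
  have hs0 : 0 ≤ s := mul_nonneg (Finset.sum_nonneg fun i _ => hq i) ha
  rw [Fintype.sum_prod_type]
  simp only [Fintype.sum_bool, potential, size_update_true, size_update_false, edgeProb, if_true,
    Bool.false_eq_true, if_false, ← hs]
  rw [Finset.sum_add_distrib, Finset.sum_const, Finset.card_univ, Fintype.card_fin, nsmul_eq_mul]
  -- Before block `j` is born everything vanishes, except when removing the edge `n` creates it;
  -- afterwards the mean growth factor is cancelled by the normalization.
  rcases lt_or_ge (cutCount y n) j with hK | hK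
  · have hlast : size y j n = 0 := (size_eq_zero_iff y j n).mpr hK
    have h1 : ∏ i : Fin (j + 1), gammaRatio (q i) (size y i n) = 0 :=
      Finset.prod_eq_zero (Finset.mem_univ (Fin.last j)) (by simp [hlast])
    have h2 : ∀ u : Fin (n + 1), ∏ i : Fin (j + 1),
        gammaRatio (q i) (size y i n + if label y u = (i : ℕ) then 1 else 0) = 0 := by
      intro u
      have := label_le_cutCount y n u (Nat.lt_succ_iff.mp u.isLt)
      refine Finset.prod_eq_zero (Finset.mem_univ (Fin.last j)) ?_
      rw [Fin.val_last, hlast, if_neg (by omega)]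
      simp
    simp only [h1, h2, birth, mul_zero, Finset.sum_const_zero, add_zero, zero_add, ← hs]
    by_cases hj : cutCount y n + 1 = j
    · have h3 : ∀ i : Fin (j + 1), (cutCount y n + 1 = (i : ℕ)) = ((i : ℕ) = j) := fun i => by
        rw [hj]; exact propext eq_comm
      simp only [h3, if_pos hj]
      push_cast
      field_simp
    · rw [if_neg hj, mul_zero,
        Finset.prod_eq_zero (Finset.mem_univ (Fin.last j)) (by simp [hlast, hj]), mul_zero,
        mul_zero, mul_zero]
  · have hpos : ∀ i : Fin (j + 1), 0 < size y i n := fun i =>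
      (size_pos_iff y i n).mpr (by have := i.isLt; omega)
    have h1 : ∀ i : Fin (j + 1), ¬ cutCount y n + 1 = (i : ℕ) := fun i => by
      have := i.isLt; omega
    have hb : birth a q n y = 0 := by rw [birth, if_neg (by omega)]
    simp only [prod_gammaRatio_add_one hq _ hpos, h1, if_false, add_zero, hb, mul_zero]
    set T := ∏ i : Fin (j + 1), gammaRatio (q i) (size y i n) with hT
    have hg := gammaRatio_pos hs0 (Nat.succ_pos n)
    have hgs := gammaRatio_succ hs0 (Nat.succ_pos n)
    simp only [Nat.succ_eq_add_one] at hg hgs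
    simp only [mul_add, Finset.sum_add_distrib, mul_one, Finset.sum_const, Finset.card_univ,
      Fintype.card_fin, nsmul_eq_mul, ← Finset.mul_sum]
    rw [sum_label_div y n hK, hgs]
    have : (∑ i, q i) * a = s := rfl
    push_cast
    have h3 : 0 < n + 1 + s := by positivity
    have h4 : 1 + s / ((n : ℝ) + 1) ≠ 0 := by positivity
    field_simp
    rw [← this]
    ring

end

/-! ### Moment bounds and passage to the limit. -/

/-- Convergence of the integrals of an almost surely convergent sequence of nonnegative functions
that is bounded in `L²`. -/
lemma integrable_and_tendsto_integral_of_sq_le {Ω : Type*} [MeasurableSpace Ω] {P : Measure Ω}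
    [IsProbabilityMeasure P] {f : ℕ → Ω → ℝ} {g : Ω → ℝ} {C : ℝ}
    (hm : ∀ n, Measurable (f n)) (h0 : ∀ n ω, 0 ≤ f n ω)
    (hint : ∀ n, Integrable (fun ω => f n ω ^ 2) P) (hC : ∀ n, ∫ ω, f n ω ^ 2 ∂P ≤ C)
    (hlim : ∀ᵐ ω ∂P, Tendsto (fun n => f n ω) atTop (𝓝 (g ω))) :
    Integrable g P ∧ Tendsto (fun n => ∫ ω, f n ω ∂P) atTop (𝓝 (∫ ω, g ω ∂P)) := by
  have hC0 : 0 ≤ C := (integral_nonneg fun ω => sq_nonneg (f 0 ω)).trans (hC 0)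
  have hUI : UniformIntegrable f 1 P := by
    refine uniformIntegrable_of le_rfl ENNReal.one_ne_top
      (fun n => (hm n).aestronglyMeasurable) fun ε hε => ?_
    -- Where `f n ≥ K`, one has `f n ≤ f n ^ 2 / K`, whose integral is at most `C / K ≤ ε`; the `+
    -- 1` keeps `K` positive when `C = 0`.
    set K : ℝ := (C + 1) / ε with hK
    have hK0 : 0 < K := by positivity
    refine ⟨⟨K, hK0.le⟩, fun n => ?_⟩
    rw [eLpNorm_one_eq_lintegral_enorm]
    calc ∫⁻ ω, ‖{x | (⟨K, hK0.le⟩ : NNReal) ≤ ‖f n x‖₊}.indicator (f n) ω‖ₑ ∂P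
        ≤ ∫⁻ ω, ENNReal.ofReal (f n ω ^ 2 / K) ∂P := by
          refine lintegral_mono fun ω => ?_
          rw [Set.indicator_apply]
          split_ifs with h
          · have h' : K ≤ f n ω := by
              have h2 : K ≤ ‖f n ω‖ := h
              rwa [Real.norm_of_nonneg (h0 n ω)] at h2
            rw [Real.enorm_eq_ofReal (h0 n ω)]
            refine ENNReal.ofReal_le_ofReal ?_
            rw [le_div_iff₀ hK0, sq]
            exact mul_le_mul_of_nonneg_left h' (h0 n ω)
          · simp
      _ = ENNReal.ofReal (∫ ω, f n ω ^ 2 / K ∂P) :=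
          (ofReal_integral_eq_lintegral_ofReal ((hint n).div_const K)
            (ae_of_all _ fun ω => by positivity)).symm
      _ ≤ ENNReal.ofReal ε := by
          refine ENNReal.ofReal_le_ofReal ?_
          rw [integral_div, div_le_iff₀ hK0, hK, mul_div_cancel₀ _ hε.ne']
          linarith [hC n]
  have hg : MemLp g 1 P := hUI.memLp_of_ae_tendsto hlim
  have hgi := memLp_one_iff_integrable.mp hg
  have hfi : ∀ n, Integrable (f n) P := fun n => memLp_one_iff_integrable.mp (hUI.memLp n)
  refine ⟨hgi, tendsto_integral_of_L1' g hgi.aestronglyMeasurable (Eventually.of_forall hfi) ?_⟩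
  exact tendsto_Lp_finite_of_tendsto_ae le_rfl ENNReal.one_ne_top
    (fun n => (hm n).aestronglyMeasurable) hg hUI.unifIntegrable hlim

section

variable {a : ℝ} {j : ℕ} {q : Fin (j + 1) → ℝ}

/-- `birth` grows at most polynomially and decays exponentially in the number of removed edges. -/
lemma exists_birth_le (ha : 0 ≤ a) (hq : ∀ i, 0 ≤ q i) :
    ∃ (C : ℝ) (N : ℕ), 0 ≤ C ∧ ∀ n y,
      birth a q n y ≤ C * ((n + 2 : ℕ) : ℝ) ^ N * (1 / 2) ^ cutCount y n := by
  have hs0 : 0 ≤ (∑ i, q i) * a := mul_nonneg (Finset.sum_nonneg fun i _ => hq i) ha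
  obtain ⟨C₀, hC₀, hb₀⟩ := exists_gammaRatio_bounds hs0
  choose D hD hbD using fun i => exists_gammaRatio_bounds (hq i)
  set Q := ∑ i, q i with hQ
  -- Where `birth` is nonzero, `cutCount y n = j - 1`, so `2 ^ j` compensates the power of `1 / 2`.
  -- Rounding `Q` up gives a natural exponent, as needed for comparison with a geometric series.
  refine ⟨C₀ * (∏ i, D i) * 2 ^ j, ⌈Q⌉₊, ?_, fun n y => ?_⟩
  · have := Finset.prod_nonneg fun i (_ : i ∈ Finset.univ) => (hD i).le
    positivity
  have hn1 : (1 : ℝ) ≤ ((n + 2 : ℕ) : ℝ) := by exact_mod_cast (by omega : 1 ≤ n + 2)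
  have hn0 : (0 : ℝ) < ((n + 2 : ℕ) : ℝ) := by linarith
  have hDp := Finset.prod_nonneg fun i (_ : i ∈ Finset.univ) => (hD i).le
  rw [birth]
  split_ifs with hK
  · have h1 : (gammaRatio (Q * a) (n + 2))⁻¹ ≤ C₀ := by
      have hg := gammaRatio_pos hs0 (show 0 < n + 2 by omega)
      rw [inv_le_iff_one_le_mul₀ hg]
      exact (Real.one_le_rpow hn1 hs0).trans (hb₀ (n + 2) (by omega)).2
    have h2 : ∏ i : Fin (j + 1), gammaRatio (q i) (size y i n + if (i : ℕ) = j then 1 else 0) ≤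
        (∏ i, D i) * ((n + 2 : ℕ) : ℝ) ^ ⌈Q⌉₊ := by
      calc _ ≤ ∏ i, D i * ((n + 2 : ℕ) : ℝ) ^ q i := by
            refine Finset.prod_le_prod (fun i _ => gammaRatio_nonneg (hq i) _) fun i _ => ?_
            set m := size y i n + if (i : ℕ) = j then 1 else 0 with hm
            have hmle : m ≤ n + 2 := by
              have := size_le y i n
              simp only [hm]; split_ifs <;> omega
            rcases Nat.eq_zero_or_pos m with h0 | h0
            · rw [h0, gammaRatio_zero_right]
              exact mul_nonneg (hD i).le (by positivity)
            · refine ((hbD i) m h0).1.trans (mul_le_mul_of_nonneg_left ?_ (hD i).le)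
              exact Real.rpow_le_rpow (by positivity) (by exact_mod_cast hmle) (hq i)
        _ = (∏ i, D i) * ((n + 2 : ℕ) : ℝ) ^ Q := by
            rw [Finset.prod_mul_distrib, Real.rpow_sum_of_pos hn0]
        _ ≤ _ := by
            refine mul_le_mul_of_nonneg_left ?_ hDp
            rw [← Real.rpow_natCast]
            exact Real.rpow_le_rpow_of_exponent_le hn1 (Nat.le_ceil Q)
    have h3 : (1 : ℝ) ≤ 2 ^ j * (1 / 2) ^ cutCount y n := by
      rw [← hK, pow_succ, mul_right_comm, ← mul_pow]
      norm_num
    calc _ ≤ C₀ * ((∏ i, D i) * ((n + 2 : ℕ) : ℝ) ^ ⌈Q⌉₊) :=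
          mul_le_mul h1 h2 (Finset.prod_nonneg fun i _ => gammaRatio_nonneg (hq i) _) hC₀.le
      _ ≤ C₀ * ((∏ i, D i) * ((n + 2 : ℕ) : ℝ) ^ ⌈Q⌉₊) * (2 ^ j * (1 / 2) ^ cutCount y n) :=
          le_mul_of_one_le_right (by positivity) h3
      _ = _ := by ring
  · positivity

/-- `gammaRatio s m ^ 2` and `gammaRatio (2 * s) m` are both of order `m ^ (2 * s)`. First-moment
bounds for all exponents thus yield `L²` bounds. -/
lemma exists_potential_sq_le (ha : 0 ≤ a) (hq : ∀ i, 0 ≤ q i) :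
    ∃ C : ℝ, ∀ n y, potential a q n y ^ 2 ≤ C * potential a (fun i => 2 * q i) n y := by
  have key : ∀ {s : ℝ}, 0 ≤ s → ∃ C : ℝ, 0 < C ∧ ∀ m : ℕ, 0 < m →
      gammaRatio s m ^ 2 ≤ C * gammaRatio (2 * s) m ∧
      gammaRatio (2 * s) m ≤ C * gammaRatio s m ^ 2 := by
    intro s hs
    obtain ⟨C, hC, h⟩ := exists_gammaRatio_bounds hs
    obtain ⟨D, hD, h'⟩ := exists_gammaRatio_bounds (s := 2 * s) (by positivity)
    refine ⟨C ^ 2 * D, by positivity, fun m hm => ?_⟩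
    have hp : (m : ℝ) ^ (2 * s) = ((m : ℝ) ^ s) ^ 2 := by
      rw [mul_comm, Real.rpow_mul (by positivity)]
      norm_cast
    have g0 := gammaRatio_nonneg hs m
    have p0 : 0 ≤ (m : ℝ) ^ s := by positivity
    obtain ⟨h1, h2⟩ := h m hm
    obtain ⟨h3, h4⟩ := h' m hm
    rw [hp] at h3 h4
    constructor
    · calc gammaRatio s m ^ 2 ≤ (C * (m : ℝ) ^ s) ^ 2 := pow_le_pow_left₀ g0 h1 2
        _ = C ^ 2 * ((m : ℝ) ^ s) ^ 2 := by ring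
        _ ≤ C ^ 2 * (D * gammaRatio (2 * s) m) := mul_le_mul_of_nonneg_left h4 (by positivity)
        _ = _ := by ring
    · calc gammaRatio (2 * s) m ≤ D * ((m : ℝ) ^ s) ^ 2 := h3
        _ ≤ D * (C * gammaRatio s m) ^ 2 :=
            mul_le_mul_of_nonneg_left (pow_le_pow_left₀ p0 h2 2) hD.le
        _ = _ := by ring
  have hs0 : 0 ≤ (∑ i, q i) * a := mul_nonneg (Finset.sum_nonneg fun i _ => hq i) ha
  obtain ⟨C₀, hC₀, h₀⟩ := key hs0
  choose D hD hbD using fun i => key (hq i)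
  refine ⟨C₀ * ∏ i, D i, fun n y => ?_⟩
  have hg := gammaRatio_pos hs0 n.succ_pos
  have hg2 := gammaRatio_pos (s := 2 * ((∑ i, q i) * a)) (by positivity) n.succ_pos
  rw [potential, potential, ← Finset.mul_sum, mul_assoc 2, mul_pow, ← Finset.prod_pow]
  have h1 : (gammaRatio ((∑ i, q i) * a) (n + 1))⁻¹ ^ 2 ≤
      C₀ * (gammaRatio (2 * ((∑ i, q i) * a)) (n + 1))⁻¹ := by
    rw [inv_pow, ← div_eq_mul_inv, le_div_iff₀ hg2, inv_mul_le_iff₀ (by positivity),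
      mul_comm _ C₀]
    exact (h₀ _ n.succ_pos).2
  have h2 : ∏ i : Fin (j + 1), gammaRatio (q i) (size y i n) ^ 2 ≤
      ∏ i : Fin (j + 1), (D i * gammaRatio (2 * q i) (size y i n)) := by
    refine Finset.prod_le_prod (fun i _ => sq_nonneg _) fun i _ => ?_
    rcases Nat.eq_zero_or_pos (size y i n) with h0 | h0
    · simp [h0]
    · exact (hbD i _ h0).1
  calc _ ≤ (C₀ * (gammaRatio (2 * ((∑ i, q i) * a)) (n + 1))⁻¹) *
        ∏ i : Fin (j + 1), (D i * gammaRatio (2 * q i) (size y i n)) :=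
        mul_le_mul h1 h2 (Finset.prod_nonneg fun i _ => sq_nonneg _) (by positivity)
    _ = _ := by rw [Finset.prod_mul_distrib]; ring

/-- The potential converges if the rescaled sizes do. -/
lemma tendsto_potential (ha : 0 < a) (hq : ∀ i, 0 ≤ q i) {y : Path} {x : Fin (j + 1) → ℝ}
    (hpos : ∀ i : Fin (j + 1), ∀ᶠ n in atTop, 0 < size y i n)
    (hx : ∀ i : Fin (j + 1), Tendsto (fun n : ℕ => (size y i n : ℝ) / ((n + 1 : ℕ) : ℝ) ^ a) atTop
      (𝓝 (x i))) :
    Tendsto (fun n => potential a q n y) atTop (𝓝 (∏ i, x i ^ q i)) := by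
  have hs0 : 0 ≤ (∑ i, q i) * a := mul_nonneg (Finset.sum_nonneg fun i _ => hq i) ha.le
  have hd : Tendsto (fun n : ℕ => ((n + 1 : ℕ) : ℝ) ^ a) atTop atTop :=
    (tendsto_rpow_atTop ha).comp (tendsto_natCast_atTop_atTop.comp (tendsto_add_atTop_nat 1))
  have h1 := tendsto_finsetProd Finset.univ fun i _ =>
    tendsto_gammaRatio_div (hq i) (hpos i) hd (hx i)
  have h2 := ((tendsto_rpow_div_gammaRatio hs0).comp (tendsto_add_atTop_nat 1)).mul h1
  rw [one_mul] at h2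
  refine h2.congr fun n => ?_
  have hn : (0 : ℝ) < ((n + 1 : ℕ) : ℝ) := by positivity
  simp only [Function.comp_apply, potential]
  rw [Finset.prod_div_distrib, ← Real.rpow_sum_of_pos (by positivity), ← Real.rpow_mul hn.le,
    mul_comm a]
  have := gammaRatio_pos hs0 n.succ_pos
  have hp := Real.rpow_pos_of_pos hn ((∑ i, q i) * a)
  simp only [Nat.succ_eq_add_one] at this
  field_simp

/-- If block `i` is nonempty, so are the earlier ones, and their factors with exponent `0` equal
`1`; otherwise both sides vanish. -/
lemma potential_single (i n : ℕ) (y : Path) :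
    potential a (Pi.single (Fin.last i) 1 : Fin (i + 1) → ℝ) n y =
      (gammaRatio a (n + 1))⁻¹ * size y i n := by
  rw [potential, Finset.sum_pi_single', if_pos (Finset.mem_univ _), one_mul,
    Fin.prod_univ_castSucc, Pi.single_eq_same, gammaRatio_one_left, Fin.val_last]
  rcases Nat.eq_zero_or_pos (size y i n) with h0 | h0
  · simp [h0]
  · rw [Finset.prod_eq_one, one_mul]
    intro k _
    rw [Pi.single_eq_of_ne (Fin.castSucc_lt_last k).ne]
    refine gammaRatio_zero_left ((size_pos_iff y _ n).mpr ?_)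
    have := (size_pos_iff y i n).mp h0
    have := k.isLt
    simp only [Fin.val_castSucc]
    omega

end

section

variable {Ω : Type*} [MeasurableSpace Ω] {P : Measure Ω} [IsProbabilityMeasure P] {a : ℝ}
  {Y : Ω → Path} {j : ℕ} {q : Fin (j + 1) → ℝ}

/-- The generating function at `1 / 2` of the binomial number of removed edges; its geometric decay
makes a late birth unlikely. -/
lemma IsPercolation.integral_half_pow (hY : IsPercolation P a Y) (n : ℕ) :
    ∫ ω, (1 / 2 : ℝ) ^ cutCount (Y ω) n ∂P = ((1 + a) / 2) ^ n := by
  have hloc : ∀ n, IsLocal n fun y => (1 / 2 : ℝ) ^ cutCount y n := fun n y y' h => by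
    simp only [cutCount_congr h]
  induction n with
  | zero => simp [cutCount_zero]
  | succ n ih =>
    rw [hY.integral_succ (hloc (n + 1)), pow_succ, ← ih, ← integral_mul_const]
    congr 1
    funext ω
    have h : ∀ x, cutCount (Function.update (Y ω) n x) n = cutCount (Y ω) n := fun x =>
      cutCount_congr fun e he => by rw [Function.update_of_ne he.ne]
    rw [Fintype.sum_prod_type]
    simp only [cutCount_succ, h, Function.update_self, Fintype.sum_bool, edgeProb, if_true,
      Bool.false_eq_true, if_false, add_zero, Finset.sum_const, Finset.card_univ, Fintype.card_fin,
      nsmul_eq_mul]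
    push_cast
    field_simp
    ring

lemma IsPercolation.integral_potential (hY : IsPercolation P a Y) (ha : 0 ≤ a)
    (hq : ∀ i, 0 ≤ q i) (n : ℕ) :
    ∫ ω, potential a q n (Y ω) ∂P = (∫ ω, potential a q 0 (Y ω) ∂P) +
      ∑ m ∈ Finset.range n, (1 - a) * ∫ ω, birth a q m (Y ω) ∂P := by
  induction n with
  | zero => simp
  | succ n ih =>
    rw [hY.integral_succ (isLocal_potential a q (n + 1)), Finset.sum_range_succ, ← add_assoc, ← ih,
      ← integral_const_mul, ← integral_add (hY.integrable (isLocal_potential a q n))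
        ((hY.integrable (isLocal_birth a q n)).const_mul _)]
    simp only [sum_edgeProb_potential ha hq]

/-- The mean birth contributions are at most a polynomial times `((1 + a) / 2) ^ m`, hence summable.
-/
lemma IsPercolation.exists_integral_potential_le (hY : IsPercolation P a Y) (ha : 0 ≤ a)
    (ha1 : a < 1) (hq : ∀ i, 0 ≤ q i) : ∃ R : ℝ, ∀ n, ∫ ω, potential a q n (Y ω) ∂P ≤ R := by
  obtain ⟨C, N, hC, hb⟩ := exists_birth_le ha hq
  set r := (1 + a) / 2 with hr
  have hr1 : ‖r‖ < 1 := by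
    rw [Real.norm_of_nonneg (by positivity)]
    linarith
  have hsum : Summable fun m : ℕ => C * (((m + 2 : ℕ) : ℝ) ^ N * r ^ m) := by
    have h : Summable fun m : ℕ => ((m + 2 : ℕ) : ℝ) ^ N * r ^ (m + 2) :=
      (summable_nat_add_iff (f := fun m : ℕ => (m : ℝ) ^ N * r ^ m) 2).mpr
        (summable_pow_mul_geometric_of_norm_lt_one N hr1)
    refine ((h.mul_left ((r ^ 2)⁻¹)).mul_left C).congr fun m => ?_
    have hr0 : 0 < r := by positivity
    rw [pow_add r, mul_comm (r ^ m), mul_left_comm _ (r ^ 2), inv_mul_cancel_left₀ (by positivity)]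
  refine ⟨(∫ ω, potential a q 0 (Y ω) ∂P) + ∑' m : ℕ, C * (((m + 2 : ℕ) : ℝ) ^ N * r ^ m),
    fun n => ?_⟩
  rw [hY.integral_potential ha hq]
  refine add_le_add_right ((Finset.sum_le_sum fun m _ => ?_).trans
    (hsum.sum_le_tsum _ fun m _ => by positivity)) _
  have h0 : 0 ≤ ∫ ω, birth a q m (Y ω) ∂P := integral_nonneg fun ω => birth_nonneg ha hq m _
  calc (1 - a) * ∫ ω, birth a q m (Y ω) ∂P ≤ ∫ ω, birth a q m (Y ω) ∂P :=
        mul_le_of_le_one_left h0 (by linarith)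
    _ ≤ ∫ ω, C * ((m + 2 : ℕ) : ℝ) ^ N * (1 / 2) ^ cutCount (Y ω) m ∂P :=
        integral_mono (hY.integrable (isLocal_birth a q m))
          ((hY.integrable (n := m) (f := fun y => (1 / 2 : ℝ) ^ cutCount y m)
            fun y y' h => by simp only [cutCount_congr h]).const_mul _) fun ω => hb m (Y ω)
    _ = _ := by rw [integral_const_mul, hY.integral_half_pow]; ring

/-- Almost surely, every block is eventually nonempty. -/
lemma IsPercolation.ae_eventually_size_pos (hY : IsPercolation P a Y) (ha : 0 ≤ a) (ha1 : a < 1)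
    (i : ℕ) : ∀ᵐ ω ∂P, ∀ᶠ n in atTop, 0 < size (Y ω) i n := by
  have hzero : P.real {ω | ∀ n, cutCount (Y ω) n < i} = 0 := by
    have hlim : Tendsto (fun n : ℕ => 2 ^ i * ((1 + a) / 2) ^ n) atTop (𝓝 0) := by
      have h := (tendsto_pow_atTop_nhds_zero_of_lt_one (r := (1 + a) / 2) (by positivity)
        (by linarith)).const_mul (2 ^ i)
      rwa [mul_zero] at h
    refine le_antisymm (ge_of_tendsto' hlim fun n => ?_) measureReal_nonneg
    -- Markov's inequality for `(1 / 2) ^ cutCount`.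
    have h := mul_meas_ge_le_integral_of_nonneg (μ := P)
      (f := fun ω => (1 / 2 : ℝ) ^ cutCount (Y ω) n) (ae_of_all _ fun ω => by positivity)
      (hY.integrable (n := n) (f := fun y => (1 / 2 : ℝ) ^ cutCount y n)
        fun y y' h => by simp only [cutCount_congr h]) ((1 / 2) ^ i)
    rw [hY.integral_half_pow] at h
    have hsub : P.real {ω | ∀ n, cutCount (Y ω) n < i} ≤
        P.real {ω | (1 / 2 : ℝ) ^ i ≤ (1 / 2) ^ cutCount (Y ω) n} :=
      measureReal_mono fun ω hω =>
        pow_le_pow_of_le_one (a := (1 / 2 : ℝ)) (by norm_num) (by norm_num) (hω n).le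
    calc _ ≤ _ := hsub
      _ = 2 ^ i * ((1 / 2) ^ i * P.real {ω | (1 / 2 : ℝ) ^ i ≤ (1 / 2) ^ cutCount (Y ω) n}) := by
          rw [← mul_assoc, ← mul_pow]; norm_num
      _ ≤ _ := mul_le_mul_of_nonneg_left h (by positivity)
  rw [measureReal_eq_zero_iff] at hzero
  refine (measure_eq_zero_iff_ae_notMem.mp hzero).mono fun ω hω => ?_
  simp only [Set.mem_ofPred_eq, not_forall, not_lt] at hω
  obtain ⟨n, hn⟩ := hω
  filter_upwards [eventually_ge_atTop n] with m hm
  exact (size_pos_iff _ _ _).mpr (hn.trans (cutCount_mono _ hm))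

/-- Almost surely, the rescaled size of every block converges. -/
lemma IsPercolation.ae_exists_tendsto_size (hY : IsPercolation P a Y) (ha : 0 ≤ a) (ha1 : a < 1)
    (i : ℕ) : ∀ᵐ ω ∂P, ∃ x, Tendsto
      (fun n : ℕ => (size (Y ω) i n : ℝ) / ((n + 1 : ℕ) : ℝ) ^ a) atTop (𝓝 x) := by
  -- For this `q`, `potential` is `size / gammaRatio a (n + 1)`, a nonnegative submartingale bounded
  -- in `L¹`, hence almost surely convergent.
  set q : Fin (i + 1) → ℝ := Pi.single (Fin.last i) 1 with hq_def
  have hq : ∀ k, 0 ≤ q k := fun k => by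
    rw [hq_def, Pi.single_apply]; split_ifs <;> norm_num
  obtain ⟨R, hR⟩ := hY.exists_integral_potential_le ha ha1 hq
  have hsub := hY.submartingale (f := potential a q) (isLocal_potential a q) fun n y => by
    rw [sum_edgeProb_potential ha hq]
    exact le_add_of_nonneg_right (mul_nonneg (by linarith) (birth_nonneg ha hq n y))
  have hbdd : ∀ n, eLpNorm (fun ω => potential a q n (Y ω)) 1 P ≤ (R.toNNReal : ENNReal) := by
    intro n
    rw [eLpNorm_one_eq_lintegral_enorm,
      ← ofReal_integral_norm_eq_lintegral_enorm (hY.integrable (isLocal_potential a q n))]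
    refine ENNReal.ofReal_le_ofReal ?_
    simp only [Real.norm_of_nonneg (potential_nonneg ha hq n _)]
    exact hR n
  filter_upwards [hsub.exists_ae_tendsto_of_bdd hbdd] with ω ⟨x, hx⟩
  have h2 := ((tendsto_rpow_div_gammaRatio ha).inv₀ one_ne_zero).comp (tendsto_add_atTop_nat 1)
  refine ⟨_, (h2.mul hx).congr fun n => ?_⟩
  have := gammaRatio_pos ha n.succ_pos
  simp only [Nat.succ_eq_add_one] at this
  rw [hq_def, potential_single]
  simp only [Function.comp_apply, inv_div]
  field_simp

/-- The moments of the limits of the rescaled sizes. -/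
lemma IsPercolation.integrable_and_tendsto (hY : IsPercolation P a Y) (ha : 0 < a) (ha1 : a < 1)
    (hq : ∀ i, 0 ≤ q i) {X : Fin (j + 1) → Ω → ℝ}
    (hX : ∀ i : Fin (j + 1), ∀ᵐ ω ∂P, Tendsto
      (fun n : ℕ => (size (Y ω) i n : ℝ) / ((n + 1 : ℕ) : ℝ) ^ a) atTop (𝓝 (X i ω))) :
    Integrable (fun ω => ∏ i, X i ω ^ q i) P ∧
      Tendsto (fun n => ∫ ω, potential a q n (Y ω) ∂P) atTop (𝓝 (∫ ω, ∏ i, X i ω ^ q i ∂P)) := by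
  have hq2 : ∀ i, 0 ≤ 2 * q i := fun i => by have := hq i; positivity
  obtain ⟨C, hC⟩ := exists_potential_sq_le ha.le hq
  obtain ⟨R, hR⟩ := hY.exists_integral_potential_le ha.le ha1 hq2
  have hi : ∀ n, Integrable (fun ω => potential a q n (Y ω) ^ 2) P := fun n =>
    hY.integrable (n := n) (f := fun y => potential a q n y ^ 2) fun y y' h => by
      simp only [isLocal_potential a q n y y' h]
  refine integrable_and_tendsto_integral_of_sq_le (C := |C| * R)
    (fun n => hY.measurable_comp (isLocal_potential a q n))
    (fun n ω => potential_nonneg ha.le hq n _) hi (fun n => ?_) ?_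
  · have hi2 := hY.integrable (isLocal_potential a (fun i => 2 * q i) n)
    calc _ ≤ ∫ ω, |C| * potential a (fun i => 2 * q i) n (Y ω) ∂P :=
          integral_mono (hi n) (hi2.const_mul _) fun ω => (hC n _).trans
            (mul_le_mul_of_nonneg_right (le_abs_self C) (potential_nonneg ha.le hq2 n _))
      _ ≤ _ := by
          rw [integral_const_mul]
          exact mul_le_mul_of_nonneg_left (hR n) (abs_nonneg C)
  · have hpos := ae_all_iff.mpr fun i : Fin (j + 1) =>
      hY.ae_eventually_size_pos ha.le ha1 (i : ℕ)
    filter_upwards [hpos, ae_all_iff.mpr hX] with ω h1 h2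
    exact tendsto_potential ha hq h1 h2

end

/-! ### Identification of the birth contributions through `mu` and `theta`. -/

/-- Only the number of removed edges enters: given that number, the tree and the set of removed
edges are uniform, as in the definition of `theta`. -/
lemma prod_edgeProb (a : ℝ) (y : Path) (n : ℕ) :
    ∏ e ∈ Finset.range n, edgeProb a e (y e) =
      (1 - a) ^ cutCount y n * a ^ (n - cutCount y n) / n.factorial := by
  have hcard : ((Finset.range n).filter fun e => ¬ (y e).2 = true).card = n - cutCount y n := by
    have := Finset.card_filter_add_card_filter_not (s := Finset.range n)
      (fun e => (y e).2 = true)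
    rw [Finset.card_range] at this
    rw [cutCount]
    omega
  simp only [edgeProb]
  rw [Finset.prod_div_distrib, Finset.prod_ite, Finset.prod_const, Finset.prod_const, hcard,
    ← Finset.prod_range_add_one_eq_factorial]
  push_cast
  rfl

lemma card_recTree (n : ℕ) : Fintype.card (RecTree n) = n.factorial := by
  rw [Fintype.card_pi, ← Finset.prod_range_add_one_eq_factorial,
    ← Fin.prod_univ_eq_prod_range fun e => e + 1]
  simp

/-- The average of `G` under `theta`, as a sum over recursive trees with `j - 1` removed edges. -/
lemma sum_theta_mul {j m : ℕ} (hj : 1 ≤ j) (G : (Fin j → ℕ) → ℝ) :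
    ∑ κ ∈ (Finset.piAntidiag (Finset.univ : Finset (Fin j)) (m + 1)).filter (fun κ => ∀ i, 1 ≤ κ i),
      theta j (m + 1) κ * G κ =
    (∑ x ∈ (Finset.univ ×ˢ Finset.powersetCard (j - 1) Finset.univ :
        Finset (RecTree m × Finset (Fin m))), G fun i => size (ofTree x) i m) /
      ((m.factorial : ℝ) * m.choose (j - 1)) := by
  classical
  set D : Finset (RecTree m × Finset (Fin m)) :=
    Finset.univ ×ˢ Finset.powersetCard (j - 1) Finset.univ with hD
  have hDcard : (D.card : ℝ) = (m.factorial : ℝ) * m.choose (j - 1) := by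
    rw [hD, Finset.card_product, Finset.card_powersetCard, Finset.card_univ, Finset.card_univ,
      card_recTree, Fintype.card_fin, Nat.cast_mul]
  have htheta : ∀ κ : Fin j → ℕ, theta j (m + 1) κ =
      ((D.filter fun x => (fun i : Fin j => size (ofTree x) i m) = κ).card : ℝ) / D.card := by
    intro κ
    have : theta j (m + 1) κ = ((D.filter fun x => ∀ i : Fin j,
        (block (x.1.cutGraph x.2) i).ncard = κ i).card : ℝ) / D.card := by
      rw [theta]
      congr!
    rw [this]
    simp only [ncard_block_ofTree, funext_iff]
  have hmaps : ∀ x ∈ D, (fun i : Fin j => size (ofTree x) i m) ∈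
      (Finset.piAntidiag (Finset.univ : Finset (Fin j)) (m + 1)).filter (fun κ => ∀ i, 1 ≤ κ i) := by
    intro x hx
    have hc : cutCount (ofTree x) m = j - 1 := by
      rw [cutCount_ofTree]
      exact (Finset.mem_powersetCard.mp (Finset.mem_product.mp hx).2).2
    rw [Finset.mem_filter, Finset.mem_piAntidiag]
    refine ⟨⟨?_, fun i _ => Finset.mem_univ i⟩, fun i => ?_⟩
    · rw [Fin.sum_univ_eq_sum_range fun i => size (ofTree x) i m]
      exact sum_size _ _ _ (by omega)
    · exact (size_pos_iff _ _ _).mpr (by have := i.isLt; omega)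
  rw [← hDcard, ← Finset.sum_fiberwise_of_maps_to hmaps, Finset.sum_div]
  refine Finset.sum_congr rfl fun κ _ => ?_
  rw [htheta, Finset.sum_congr rfl fun x hx => by rw [(Finset.mem_filter.mp hx).2],
    Finset.sum_const, nsmul_eq_mul, div_mul_eq_mul_div]

/-- The edge `m` leads to the vertex `k = m + 2` counted from `1`. Exactly `j - 1` removals among
the first `m` edges, followed by that of the edge `m`, have probability `mu j t (m + 2)`; the number
of trees and of edge sets cancels the denominator of `theta`. -/
lemma IsPercolation.integral_birth {Ω : Type*} [MeasurableSpace Ω] {P : Measure Ω}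
    [IsProbabilityMeasure P] {t : ℝ} {Y : Ω → Path} (hY : IsPercolation P (Real.exp (-t)) Y)
    {j : ℕ} (hj : 1 ≤ j) (q : Fin (j + 1) → ℝ) (m : ℕ) :
    (1 - Real.exp (-t)) * ∫ ω, birth (Real.exp (-t)) q m (Y ω) ∂P =
      mu j t (m + 2) *
        ∑ κ ∈ (Finset.piAntidiag (Finset.univ : Finset (Fin j)) (m + 1)).filter
            (fun κ => ∀ i, 1 ≤ κ i),
          theta j (m + 1) κ *
            (Real.Gamma ((m + 2 : ℕ) : ℝ) /
              Real.Gamma ((∑ i, q i) * Real.exp (-t) + ((m + 2 : ℕ) : ℝ))) *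
            ∏ i : Fin (j + 1),
              Real.Gamma (q i + ((Fin.snoc κ 1 : Fin (j + 1) → ℕ) i : ℝ)) /
                Real.Gamma ((Fin.snoc κ 1 : Fin (j + 1) → ℕ) i : ℝ) := by
  classical
  set a := Real.exp (-t) with ha
  set D : Finset (RecTree m × Finset (Fin m)) :=
    Finset.univ ×ˢ Finset.powersetCard (j - 1) Finset.univ with hD
  set G : (Fin j → ℕ) → ℝ := fun κ => (gammaRatio ((∑ i, q i) * a) (m + 2))⁻¹ *
    ∏ i, gammaRatio (q i) ((Fin.snoc κ 1 : Fin (j + 1) → ℕ) i) with hG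
  have hmemD : ∀ x : RecTree m × Finset (Fin m), x ∈ D ↔ cutCount (ofTree x) m + 1 = j := by
    intro x
    rw [hD, Finset.mem_product, Finset.mem_powersetCard, cutCount_ofTree]
    simp only [Finset.mem_univ, Finset.subset_univ, true_and]
    omega
  have hbirth : ∀ x : RecTree m × Finset (Fin m), birth a q m (ofTree x) =
      if x ∈ D then G fun i => size (ofTree x) i m else 0 := by
    intro x
    simp only [birth, hmemD, hG]
    split_ifs with hx
    · congr 1
      refine Finset.prod_congr rfl fun i _ => ?_
      congr 1
      -- The last block is empty before its birth and consists of one vertex just after, whence the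
      -- `1` appended by `Fin.snoc`.
      refine Fin.lastCases ?_ (fun i => ?_) i
      · rw [Fin.snoc_last, Fin.val_last, if_pos rfl, (size_eq_zero_iff _ _ _).mpr (by omega)]
      · rw [Fin.snoc_castSucc, Fin.val_castSucc, if_neg i.isLt.ne, add_zero]
    · rfl
  have hL : ∫ ω, birth a q m (Y ω) ∂P = (1 - a) ^ (j - 1) * a ^ (m - (j - 1)) / m.factorial *
      ∑ x ∈ D, G fun i => size (ofTree x) i m := by
    rw [hY.integral_eq_sum (isLocal_birth a q m), Finset.mul_sum, ← Finset.sum_filter_add_sum_filter_not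
      Finset.univ (fun x => x ∈ D)]
    rw [Finset.sum_eq_zero (s := Finset.univ.filter fun x => ¬ x ∈ D), add_zero,
      Finset.filter_univ_mem]
    · refine Finset.sum_congr rfl fun x hx => ?_
      have hc : cutCount (ofTree x) m = j - 1 := by have := (hmemD x).mp hx; omega
      rw [hbirth, if_pos hx, prod_edgeProb, hc]
    · intro x hx
      rw [hbirth, if_neg (Finset.mem_filter.mp hx).2, mul_zero]
  have hR : ∀ κ : Fin j → ℕ, theta j (m + 1) κ *
      (Real.Gamma ((m + 2 : ℕ) : ℝ) / Real.Gamma ((∑ i, q i) * a + ((m + 2 : ℕ) : ℝ))) *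
      ∏ i : Fin (j + 1), Real.Gamma (q i + ((Fin.snoc κ 1 : Fin (j + 1) → ℕ) i : ℝ)) /
        Real.Gamma ((Fin.snoc κ 1 : Fin (j + 1) → ℕ) i : ℝ) = theta j (m + 1) κ * G κ := by
    intro κ
    simp only [hG, gammaRatio, inv_div, mul_assoc]
  rw [Finset.sum_congr rfl fun κ _ => hR κ, sum_theta_mul hj, hL, mu, ← ha, ← hD]
  by_cases hjm : j + 1 ≤ m + 2
  · have hch : (m.choose (j - 1) : ℝ) ≠ 0 := by
      exact_mod_cast (Nat.choose_pos (by omega)).ne'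
    have hfac : (m.factorial : ℝ) ≠ 0 := by exact_mod_cast m.factorial_ne_zero
    have h1 : m + 2 - j - 1 = m - (j - 1) := by omega
    rw [if_pos hjm, h1, Nat.add_sub_cancel, Nat.choose_symm (by omega)]
    obtain ⟨i, rfl⟩ : ∃ i, j = i + 1 := ⟨j - 1, by omega⟩
    simp only [Nat.add_sub_cancel] at hch ⊢
    rw [pow_succ (1 - a)]
    field_simp
  · have hDe : D = ∅ := by
      rw [hD, Finset.powersetCard_eq_empty.mpr (by simp; omega), Finset.product_empty]
    rw [if_neg hjm, hDe]
    simp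

/-- The shift reflects that `n` edges span `n + 1` vertices. -/
lemma rescaledSize_label (t : ℝ) (y : Path) (i n : ℕ) :
    rescaledSize t {v | label y v = i} (n + 1) =
      (size y i n : ℝ) / ((n + 1 : ℕ) : ℝ) ^ Real.exp (-t) := by
  have : {v | label y v = i} ∩ {v | v < n + 1} =
      (((Finset.range (n + 1)).filter fun v => label y v = i : Finset ℕ) : Set ℕ) := by
    ext v
    simp [and_comm]
  rw [rescaledSize, this, Set.ncard_coe_finset, Real.rpow_neg (by positivity), inv_mul_eq_div]
  rfl

end RRT

theorem proposition5 {Ω : Type*} [MeasurableSpace Ω] (P : Measure Ω) [IsProbabilityMeasure P]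
    (parent : (e : ℕ) → Ω → Fin (e + 1)) (ε : ℕ → Ω → ℝ)
    (hT : RRT.IsDestruction P parent ε)
    (t : ℝ) (ht : 0 < t) (j : ℕ) (hj : 1 ≤ j) (q : Fin (j + 1) → ℝ) (hq : ∀ i, 0 ≤ q i)
    (B : Fin (j + 1) → Ω → Set ℕ)
    (hB : ∀ i ω, B i ω = RRT.clusterAt (fun e => parent e ω) (fun e => ε e ω) t i)
    (X : Fin (j + 1) → Ω → ℝ) (hX : ∀ i ω, X i ω = RRT.weight t (B i ω)) :
    (∀ i, ∀ᵐ ω ∂P, Tendsto (RRT.rescaledSize t (B i ω)) atTop (𝓝 (X i ω))) ∧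
    Integrable (fun ω => ∏ i, X i ω ^ q i) P ∧
    HasSum
      (fun k : ℕ => RRT.mu j t k *
        ∑ κ ∈ (Finset.piAntidiag (Finset.univ : Finset (Fin j)) (k - 1)).filter
            (fun κ => ∀ i, 1 ≤ κ i),
          RRT.theta j (k - 1) κ *
            (Real.Gamma k / Real.Gamma ((∑ i, q i) * Real.exp (-t) + k)) *
            ∏ i : Fin (j + 1),
              Real.Gamma (q i + ((Fin.snoc κ 1 : Fin (j + 1) → ℕ) i : ℝ)) /
                Real.Gamma ((Fin.snoc κ 1 : Fin (j + 1) → ℕ) i : ℝ))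
      (∫ ω, ∏ i, X i ω ^ q i ∂P) := by
  set a := Real.exp (-t) with ha
  have ha0 : 0 < a := Real.exp_pos _
  have ha1 : a < 1 := by simpa [ha] using ht
  set Y : Ω → RRT.Path := fun ω e => (parent e ω, decide (ε e ω ≤ t)) with hY_def
  have hY : RRT.IsPercolation P a Y := hT.isPercolation ht
  have hlim : ∀ i, ∀ᵐ ω ∂P, Tendsto (RRT.rescaledSize t (B i ω)) atTop (𝓝 (X i ω)) := by
    intro i
    filter_upwards [hY.ae_exists_tendsto_size ha0.le ha1 (i : ℕ)] with ω ⟨x, hx⟩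
    have h : Tendsto (RRT.rescaledSize t (B i ω)) atTop (𝓝 x) := by
      rw [← tendsto_add_atTop_iff_nat 1, hB, RRT.clusterAt_eq]
      exact hx.congr fun n => (RRT.rescaledSize_label t (Y ω) i n).symm
    rw [hX, RRT.weight, h.limUnder_eq]
    exact h
  have hsize : ∀ i : Fin (j + 1), ∀ᵐ ω ∂P, Tendsto
      (fun n : ℕ => (RRT.size (Y ω) i n : ℝ) / ((n + 1 : ℕ) : ℝ) ^ a) atTop (𝓝 (X i ω)) := by
    intro i
    filter_upwards [hlim i] with ω h
    rw [← tendsto_add_atTop_iff_nat 1, hB, RRT.clusterAt_eq] at h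
    exact h.congr fun n => RRT.rescaledSize_label t (Y ω) i n
  obtain ⟨hint, hconv⟩ := hY.integrable_and_tendsto ha0 ha1 hq hsize
  refine ⟨hlim, hint, ?_⟩
  have hsum : HasSum (fun m => (1 - a) * ∫ ω, RRT.birth a q m (Y ω) ∂P)
      (∫ ω, ∏ i, X i ω ^ q i ∂P) := by
    rw [hasSum_iff_tendsto_nat_of_nonneg fun m => mul_nonneg (by linarith)
      (integral_nonneg fun ω => RRT.birth_nonneg ha0.le hq m _)]
    refine hconv.congr fun n => ?_
    -- As `j ≥ 1`, block `j` is empty when only the root is present, so the sum of birth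
    -- contributions has no initial term.
    have h0 : ∀ y, RRT.potential a q 0 y = 0 := by
      intro y
      rw [RRT.potential, Finset.prod_eq_zero (Finset.mem_univ (Fin.last j)), mul_zero]
      rw [Fin.val_last, RRT.size_zero_right, if_neg (by omega), RRT.gammaRatio_zero_right]
    rw [hY.integral_potential ha0.le hq]
    simp [h0]
  -- Reindexing by `k = m + 2`; the terms `k = 0, 1` vanish because `mu j t` is supported on `k ≥ j
  -- + 1 ≥ 2`.
  rw [← hasSum_nat_add_iff' 2, Finset.sum_eq_zero (s := Finset.range 2), sub_zero]
  · exact hsum.congr_fun fun m => (hY.integral_birth hj q m).symm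
  · intro k hk
    rw [RRT.mu, if_neg (by have := Finset.mem_range.mp hk; omega), zero_mul]
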